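/- Let $m\ge 1$ and $n\ge 2$ be integers. There is a constant $C_{m,n}>0$, depending only on $m$ and $n$, such that for every real $C>C_{m,n}$ there is an unbounded Reinhardt domain $\Omega_C\subseteq\mathbb C^n$ (a non-empty connected open set that is invariant under $(z_1,\dots,z_n)\mapsto(u_1z_1,\dots,u_nz_n)$ for all $u_j\in\mathbb C$ with $|u_j|=1$) with the following properties. (1) The Bergman space $A^2(\Omega_C)$, i.e. the space of holomorphic functions on $\Omega_C$ that are square-integrable with respect to Lebesgue measure, is the linear span of the monomials $z^\alpha=z_1^{\alpha_1}\cdots z_n^{\alpha_n}$ with $\alpha\in\mathbb N^n$ and $|\alpha|=\alpha_1+\cdots+\alpha_n\le m$ (where $0\in\mathbb N$). In particular, $A^2(\Omega_C)$ separates points: for any two distinct points $x,y\in\Omega_C$ there is $f\in A^2(\Omega_C)$ with $f(x)=0$ and $f(y)\ne 0$. (2) The Bergman kernel $K_C(z,w)=\sum_k\varphi_k(z)\overline{\varphi_k(w)}$ of $\Omega_C$, where $(\varphi_k)$ is an orthonormal basis of $A^2(\Omega_C)$, satisfies $K_C(z,z)=C\,(1+\|z\|^2)^m$ for all $z\in\Omega_C$,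 with $\|z\|^2=\sum_j|z_j|^2$. Consequently, $\Omega_C$ admits a Bergman metric (for every $x\in\Omega_C$ there is $f\in A^2(\Omega_C)$ with $f(x)\neq 0$, and for every $x\in\Omega_C$ and every non-zero vector $v\in\mathbb C^n$ there is $f\in A^2(\Omega_C)$ with $f(x)=0$ and $df_x(v)\ne 0$), and this metric, with Kähler form $i\partial\bar\partial\log K_C(z,z)$, coincides on $\Omega_C\subseteq\mathbb C^n\subseteq\mathbb P^n$ (embedded by $z\mapsto[1:z]$) with $m$ times the Fubini–Study metric, which is normalized to have Kähler form $i\partial\bar\partial\log\|Z\|^2$ in homogeneous coordinates $Z$, i.e. holomorphic sectional curvature $2$. -/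

import Mathlib

open MeasureTheory ComplexConjugate

/-- `f : Ω → ℂ` is holomorphic on the open set `Ω ⊆ ℂⁿ`. -/
def IsHolomorphicOn {n : ℕ} (Ω : Set (Fin n → ℂ)) (f : Ω → ℂ) : Prop :=
  ∃ F : (Fin n → ℂ) → ℂ, DifferentiableOn ℂ F Ω ∧ ∀ z : Ω, F z = f z

/-- Lebesgue measure of `ℂⁿ = ℝ²ⁿ` on the subset `Ω`. -/
noncomputable def lebesgueOn {n : ℕ} (Ω : Set (Fin n → ℂ)) : Measure Ω :=
  (volume : Measure (Fin n → ℂ)).comap Subtype.val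

/-- The Bergman space `A²(Ω)`: the holomorphic functions on `Ω` that are square-integrable with
respect to Lebesgue measure. -/
def bergmanSpace {n : ℕ} (Ω : Set (Fin n → ℂ)) : Submodule ℂ (Ω → ℂ) where
  carrier := {f | IsHolomorphicOn Ω f ∧ MemLp f 2 (lebesgueOn Ω)}
  zero_mem' := ⟨⟨0, differentiableOn_const (0 : ℂ), fun _ => rfl⟩, MemLp.zero⟩
  add_mem' := by
    rintro f g ⟨⟨F, hF, hFf⟩, hf⟩ ⟨⟨G, hG, hGg⟩, hg⟩
    exact ⟨⟨F + G, hF.add hG, fun z => by simp [hFf, hGg]⟩, hf.add hg⟩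
  smul_mem' := by
    rintro c f ⟨⟨F, hF, hFf⟩, hf⟩
    exact ⟨⟨c • F, hF.const_smul c, fun z => by simp [hFf]⟩, hf.const_smul c⟩

/-- The `L²` inner product `⟨f, g⟩ = ∫_Ω f ḡ dV`, linear in the first variable. -/
noncomputable def bergmanInner {n : ℕ} (Ω : Set (Fin n → ℂ)) (f g : Ω → ℂ) : ℂ :=
  ∫ z, f z * conj (g z) ∂lebesgueOn Ω

/-- `φ` is an orthonormal basis of the Hilbert space `A²(Ω)`: an orthonormal family of elements
of `A²(Ω)` whose only orthogonal element in `A²(Ω)` is `0`. -/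
structure IsBergmanBasis {n : ℕ} (Ω : Set (Fin n → ℂ)) {ι : Type} (φ : ι → Ω → ℂ) : Prop where
  mem : ∀ k, φ k ∈ bergmanSpace Ω
  norm_eq_one : ∀ k, bergmanInner Ω (φ k) (φ k) = 1
  orthogonal : ∀ j k, j ≠ k → bergmanInner Ω (φ j) (φ k) = 0
  total : ∀ f ∈ bergmanSpace Ω, (∀ k, bergmanInner Ω f (φ k) = 0) → f = 0

/-- `K` is on `Ω × Ω` the Bergman kernel of `Ω`: `K(z, w) = ∑ₖ φₖ(z) conj (φₖ(w))` for an
orthonormal basis `φ` of `A²(Ω)`. The sum does not depend on the choice of the basis. The values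
of `K` outside `Ω × Ω` are irrelevant. -/
def IsBergmanKernel {n : ℕ} (Ω : Set (Fin n → ℂ)) (K : (Fin n → ℂ) → (Fin n → ℂ) → ℂ) : Prop :=
  ∃ (ι : Type) (φ : ι → Ω → ℂ), IsBergmanBasis Ω φ ∧
    ∀ z w : Ω, HasSum (fun k => φ k z * conj (φ k w)) (K z w)

/-- The monomial `z^α = ∏ⱼ zⱼ^αⱼ`, as a function on `Ω`. -/
def monomialOn {n : ℕ} (Ω : Set (Fin n → ℂ)) (α : Fin n → ℕ) : Ω → ℂ :=
  fun z => ∏ j, (z : Fin n → ℂ) j ^ α j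

/-- A domain: a non-empty connected open set. -/
def IsDomainIn {n : ℕ} (Ω : Set (Fin n → ℂ)) : Prop :=
  IsOpen Ω ∧ IsConnected Ω

/-- `Ω` is invariant under independent rotations of the coordinates. -/
def IsReinhardt {n : ℕ} (Ω : Set (Fin n → ℂ)) : Prop :=
  ∀ z ∈ Ω, ∀ u : Fin n → ℂ, (∀ j, ‖u j‖ = 1) → (fun j => u j * z j) ∈ Ω

/-- `A²(Ω)` separates points. -/
def BergmanSeparatesPoints {n : ℕ} (Ω : Set (Fin n → ℂ)) : Prop :=
  ∀ x y : Ω, x ≠ y → ∃ f ∈ bergmanSpace Ω, f x = 0 ∧ f y ≠ 0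

/-- `A²(Ω)` is base point free. -/
def BergmanBasePointFree {n : ℕ} (Ω : Set (Fin n → ℂ)) : Prop :=
  ∀ x : Ω, ∃ f ∈ bergmanSpace Ω, f x ≠ 0

/-- `A²(Ω)` separates holomorphic directions. -/
def BergmanSeparatesDirections {n : ℕ} (Ω : Set (Fin n → ℂ)) : Prop :=
  ∀ x ∈ Ω, ∀ v : Fin n → ℂ, v ≠ 0 → ∃ F : (Fin n → ℂ) → ℂ, DifferentiableOn ℂ F Ω ∧
    Ω.domRestrict F ∈ bergmanSpace Ω ∧ F x = 0 ∧ fderiv ℂ F x v ≠ 0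

/-- `∂f/∂zⱼ = (∂f/∂xⱼ - i ∂f/∂yⱼ) / 2`. -/
noncomputable def wirtinger {n : ℕ} (j : Fin n) (f : (Fin n → ℂ) → ℂ) (z : Fin n → ℂ) : ℂ :=
  (fderiv ℝ f z (Pi.single j 1) - Complex.I * fderiv ℝ f z (Pi.single j Complex.I)) / 2

/-- `∂f/∂z̄ⱼ = (∂f/∂xⱼ + i ∂f/∂yⱼ) / 2`. -/
noncomputable def wirtingerBar {n : ℕ} (j : Fin n) (f : (Fin n → ℂ) → ℂ) (z : Fin n → ℂ) : ℂ :=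
  (fderiv ℝ f z (Pi.single j 1) + Complex.I * fderiv ℝ f z (Pi.single j Complex.I)) / 2

/-- The Hermitian form `∑ⱼₖ (∂² log K(z,z) / ∂zⱼ ∂z̄ₖ) vⱼ conj (wₖ)` at the point `z`, that is, the
Hermitian metric with Kähler form `i ∂∂̄ log K(z,z)`; it is the Bergman metric when `K` is the
Bergman kernel. -/
noncomputable def bergmanMetric {n : ℕ} (K : (Fin n → ℂ) → (Fin n → ℂ) → ℂ)
    (z v w : Fin n → ℂ) : ℂ :=
  ∑ j, ∑ k, wirtinger j (wirtingerBar k fun x => ((Real.log (K x x).re : ℝ) : ℂ)) z *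
    v j * conj (w k)

/-- `⟨A, B⟩ = ∑ᵢ Aᵢ conj (Bᵢ)` on `ℂᴺ`. -/
def hermitianDot {N : ℕ} (A B : Fin N → ℂ) : ℂ := ∑ i, A i * conj (B i)

/-- The Fubini–Study metric of `ℙⁿ` in homogeneous coordinates: its value at the point `[Z]` on the
images in the tangent space at `[Z]` of the vectors `V, W ∈ ℂⁿ⁺¹`. Its Kähler form is
`i ∂∂̄ log ‖Z‖²`, and its holomorphic sectional curvature is `2`. -/
noncomputable def fubiniStudy {n : ℕ} (Z V W : Fin (n + 1) → ℂ) : ℂ :=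
  (hermitianDot V W * hermitianDot Z Z - hermitianDot V Z * hermitianDot Z W) /
    hermitianDot Z Z ^ 2

/-- The restriction of the Fubini–Study metric of `ℙⁿ` to `ℂⁿ`, embedded by `z ↦ [1 : z]`. -/
noncomputable def fubiniStudyAffine {n : ℕ} (z v w : Fin n → ℂ) : ℂ :=
  fubiniStudy (Fin.cons 1 z : Fin (n + 1) → ℂ) (Fin.cons 0 v) (Fin.cons 0 w)

/-! Take for `Ω` the preimage of an open set `D ⊆ ℝⁿ` under `z ↦ t = (|z₁|², …, |zₙ|²)`, and let `μ`
be the image of Lebesgue measure. Distinct monomials are orthogonal on `Ω`, and the squared norm of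
`z^α` is the moment `∫_D t^α dμ`. By the multinomial theorem the kernel is `C (1 + ∑ zⱼ w̄ⱼ)^m` once
the moments of order at most `m` are `∏ bᵢ! / (m! C)` with `b = (m - |α|, α)`, and the moments of
higher order are infinite. The logarithm of the diagonal then has `m` times the Fubini–Study form as
its `i∂∂̄`. So it suffices to construct a connected `D` with these moments.

Bergman space (`bergmanSpace_eq_span_monomials`). The Fourier coefficients of a function in `A²(Ω)`
along torus orbits are again square-integrable. If `0 ∈ Ω`, they are multiples of monomials, hence
all but finitely many vanish and the Fourier series is a finite sum.

Divergence and connectedness (`exists_isUnionOfBallsAt_comb`). Balls about `(k+1, …, k+1)` of volume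
comparable to `(k+1)^(-m-2)` have finite moments exactly up to order `m`. They are joined by a thin
neighborhood of a comb of hyperplanes. The comb is a null set, so the neighborhood can have
arbitrarily small moments; it is connected because `n ≥ 2`.

Exact moments. The vector `c = (∏ bᵢ!)` collects the moments of the degree `m` monomials in `n + 1`
variables for the weight `exp(-∑ yᵢ)` on the positive orthant. By convex separation, as in
Tchakaloff's theorem, it is a positive combination of evaluations at finitely many nodes that span
(`exists_cubature`). Replacing the nodes by small balls with their volumes as parameters gives a map
close to a surjective linear map, so the volumes can be tuned to compensate for the comb and produce
exactly `ε c` for every small `ε` (`exists_union_balls_setIntegral_eq`). The choice `ε = 1 / (m! C)`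
is why `C` must be large. -/

/-! ### Parameter integrals and the identity theorem along complex lines -/

open Topology in
/-- Holomorphic dependence on a parameter of an integral over a compact space. -/
theorem differentiableOn_integral_of_compactSpace {X : Type*} [TopologicalSpace X]
    [CompactSpace X] [MeasurableSpace X] [OpensMeasurableSpace X] (μ : Measure X)
    [IsFiniteMeasure μ] {H : ℂ → X → ℂ} {O : Set ℂ} (hO : IsOpen O)
    (hc : ContinuousOn (Function.uncurry H) (O ×ˢ Set.univ))
    (hd : ∀ x, DifferentiableOn ℂ (fun l => H l x) O) :
    DifferentiableOn ℂ (fun l => ∫ x, H l x ∂μ) O := by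
  intro l₀ hl₀
  apply DifferentiableAt.differentiableWithinAt
  obtain ⟨R, hR, hRO⟩ := Metric.nhds_basis_closedBall.mem_iff.1 (hO.mem_nhds hl₀)
  obtain ⟨M, hM⟩ := ((isCompact_closedBall l₀ R).prod (isCompact_univ (X := X))
    ).exists_bound_of_continuousOn (hc.mono (Set.prod_mono hRO subset_rfl))
  have hcont : ∀ l ∈ O, Continuous (H l) := fun l hl =>
    hc.comp_continuous (f := fun x => (l, x)) (by fun_prop) (fun x => ⟨hl, trivial⟩)
  have hmeas : ∀ l ∈ O, AEStronglyMeasurable (H l) μ := fun l hl =>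
    (hcont l hl).aestronglyMeasurable
  have hint : ∀ l ∈ O, Integrable (H l) μ := fun l hl =>
    (hcont l hl).integrable_of_hasCompactSupport (HasCompactSupport.of_compactSpace _)
  have hderiv : ∀ x, ∀ l ∈ O, HasDerivAt (fun l => H l x) (deriv (fun l => H l x) l) l :=
    fun x l hl => ((hd x l hl).differentiableAt (hO.mem_nhds hl)).hasDerivAt
  have key := hasDerivAt_integral_of_dominated_loc_of_deriv_le (μ := μ) (F := H) (x₀ := l₀)
    (s := Metric.ball l₀ (R / 2)) (bound := fun _ => M / (R / 2))
    (F' := fun l x => deriv (fun l => H l x) l) (Metric.ball_mem_nhds _ (half_pos hR))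
    (Filter.Eventually.mono (hO.mem_nhds hl₀) fun l hl => hmeas l hl) (hint l₀ hl₀)
    ?_ ?_ (integrable_const _) ?_
  · exact key.2.differentiableAt
  -- The derivative is measurable in `x` as a pointwise limit of difference quotients along `l₀ +
  -- 1/(k+1)`; the shift by `N` keeps all these points in `O`.
  · have hseq : Filter.Tendsto (fun k : ℕ => l₀ + ((1 / ((k : ℝ) + 1) : ℝ) : ℂ)) Filter.atTop
        (𝓝[≠] l₀) := by
      refine tendsto_nhdsWithin_iff.2 ⟨?_, Filter.Eventually.of_forall fun k => ?_⟩
      · have h := (Complex.continuous_ofReal.tendsto 0).comp tendsto_one_div_add_atTop_nhds_zero_nat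
        simpa using h.const_add l₀
      · have : ((k : ℝ) + 1) ≠ 0 := by positivity
        simp only [Set.mem_compl_iff, Set.mem_singleton_iff, add_eq_left]
        exact_mod_cast one_div_ne_zero this
    have hev : ∀ᶠ k : ℕ in Filter.atTop, l₀ + ((1 / ((k : ℝ) + 1) : ℝ) : ℂ) ∈ O :=
      (hseq.mono_right nhdsWithin_le_nhds).eventually (hO.mem_nhds hl₀)
    obtain ⟨N, hN⟩ := Filter.eventually_atTop.1 hev
    refine aestronglyMeasurable_of_tendsto_ae Filter.atTop
      (f := fun k : ℕ => fun x => slope (fun l => H l x) l₀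
        (l₀ + ((1 / (((k + N : ℕ) : ℝ) + 1) : ℝ) : ℂ)))
      (fun k => ?_) (Filter.Eventually.of_forall fun x => ?_)
    · simp only [slope, vsub_eq_sub]
      exact ((hmeas _ (hN _ (Nat.le_add_left N k))).sub (hmeas _ hl₀)).const_mul _
    · exact ((hasDerivAt_iff_tendsto_slope.1 (hderiv x l₀ hl₀)).comp hseq).comp
        (Filter.tendsto_add_atTop_nat N)
  · refine Filter.Eventually.of_forall fun x l hl => ?_
    have hsub : Metric.closedBall l (R / 2) ⊆ Metric.closedBall l₀ R := by
      refine Metric.closedBall_subset_closedBall' ?_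
      have := Metric.mem_ball.1 hl
      linarith
    refine Complex.norm_deriv_le_of_forall_mem_sphere_norm_le (half_pos hR) ?_ ?_
    · refine DifferentiableOn.diffContOnCl ((hd x).mono ?_)
      rw [closure_ball _ (half_pos hR).ne']
      exact hsub.trans hRO
    · intro z hz
      exact hM (z, x) ⟨hsub (Metric.sphere_subset_closedBall hz), trivial⟩
  · exact Filter.Eventually.of_forall fun x l hl =>
      hderiv x l (hRO (Metric.ball_subset_closedBall
        (Metric.ball_subset_ball (by linarith) hl)))

/-- `g` is holomorphic along the intersection of `Ω` with each complex line. -/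
def IsLineHolomorphicOn {E : Type*} [AddCommGroup E] [Module ℂ E] (g : E → ℂ) (Ω : Set E) :
    Prop :=
  ∀ z v : E, DifferentiableOn ℂ (fun l : ℂ => g (z + l • v)) {l | z + l • v ∈ Ω}

open Topology in
/-- The identity theorem for functions that are holomorphic along complex lines. -/
theorem IsLineHolomorphicOn.eqOn_zero {E : Type*} [NormedAddCommGroup E] [NormedSpace ℂ E]
    {g : E → ℂ} {Ω : Set E} (hg : IsLineHolomorphicOn g Ω) (hΩ : IsOpen Ω)
    (hc : IsPreconnected Ω) {z₀ : E} (hz₀ : z₀ ∈ Ω) (h0 : ∀ᶠ z in 𝓝 z₀, g z = 0) :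
    ∀ z ∈ Ω, g z = 0 := by
  have hsub : Ω ⊆ {z | ∀ᶠ y in 𝓝 z, g y = 0} := by
    refine hc.subset_of_closure_inter_subset isOpen_setOfPred_eventually_nhds ⟨z₀, hz₀, h0⟩ ?_
    rintro z ⟨hz, hzΩ⟩
    obtain ⟨r, hr, hrΩ⟩ := Metric.isOpen_iff.1 hΩ z hzΩ
    obtain ⟨w, hw, hwz⟩ := Metric.mem_closure_iff.1 hz r hr
    filter_upwards [Metric.ball_mem_nhds z hr] with y hy
    -- Since `g` vanishes near `w`, it vanishes near `l = 0` on the line from `w` (`l = 0`) to `y`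
    -- (`l = 1`). The ball cuts this line in a convex set, so the one-variable identity theorem
    -- reaches `y`.
    have hline : Continuous fun l : ℂ => w + l • (y - w) := by fun_prop
    have hO : IsOpen {l : ℂ | w + l • (y - w) ∈ Metric.ball z r} :=
      Metric.isOpen_ball.preimage hline
    have hconv : Convex ℝ {l : ℂ | w + l • (y - w) ∈ Metric.ball z r} := by
      intro a ha b hb s t hs ht hst
      have h := (convex_ball z r) ha hb hs ht hst
      have e : w + (s • a + t • b) • (y - w) = s • (w + a • (y - w)) + t • (w + b • (y - w)) := by
        have hw' : w = s • w + t • w := by rw [← add_smul, hst, one_smul]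
        rw [add_smul, smul_add, smul_add, smul_assoc, smul_assoc]
        nth_rw 1 [hw']
        abel
      simp only [Set.mem_ofPred_eq]
      rw [e]; exact h
    have hd := ((hg w (y - w)).mono (fun l hl => hrΩ hl)).analyticOnNhd hO
    have hev : ∀ᶠ l : ℂ in 𝓝 0, g (w + l • (y - w)) = 0 := by
      have : Filter.Tendsto (fun l : ℂ => w + l • (y - w)) (𝓝 0) (𝓝 w) := by
        simpa using hline.tendsto 0
      exact this.eventually hw
    have := hd.eqOn_zero_of_preconnected_of_eventuallyEq_zero hconv.isPreconnected
      (z₀ := 0) (Set.mem_ofPred.2 (by simpa [dist_comm] using hwz)) hev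
      (x := 1) (Set.mem_ofPred.2 (by simpa using hy))
    simpa using this
  exact fun z hz => (hsub hz).self_of_nhds

theorem DifferentiableOn.isLineHolomorphicOn {E : Type*} [NormedAddCommGroup E]
    [NormedSpace ℂ E] {g : E → ℂ} {Ω : Set E} (hg : DifferentiableOn ℂ g Ω) :
    IsLineHolomorphicOn g Ω := fun z v =>
  hg.comp (f := fun l : ℂ => z + l • v) (by fun_prop) fun _ hl => hl

theorem IsLineHolomorphicOn.sub {E : Type*} [AddCommGroup E] [Module ℂ E] {g h : E → ℂ}
    {Ω : Set E} (hg : IsLineHolomorphicOn g Ω) (hh : IsLineHolomorphicOn h Ω) :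
    IsLineHolomorphicOn (fun z => g z - h z) Ω := fun z v => (hg z v).sub (hh z v)

/-! ### Fourier analysis along torus orbits -/

/-- The normalized Haar measure of the torus `(ℝ / ℤ)ⁿ`. -/
noncomputable def torusHaar (n : ℕ) : Measure (UnitAddTorus (Fin n)) :=
  Measure.pi fun _ => AddCircle.haarAddCircle

instance (n : ℕ) : IsProbabilityMeasure (torusHaar n) :=
  inferInstanceAs (IsProbabilityMeasure (Measure.pi fun _ => AddCircle.haarAddCircle))

instance (n : ℕ) : (torusHaar n).IsAddHaarMeasure :=
  inferInstanceAs ((Measure.pi fun _ => AddCircle.haarAddCircle).IsAddHaarMeasure)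

/-- The action of the torus on `ℂⁿ`. -/
noncomputable def torusRotate {n : ℕ} (x : UnitAddTorus (Fin n)) (z : Fin n → ℂ) : Fin n → ℂ :=
  fun j => fourier 1 (x j) * z j

theorem continuous_torusRotate {n : ℕ} :
    Continuous fun p : UnitAddTorus (Fin n) × (Fin n → ℂ) => torusRotate p.1 p.2 := by
  unfold torusRotate
  fun_prop

theorem norm_fourier_apply (k : ℤ) (θ : UnitAddCircle) : ‖fourier k θ‖ = 1 := by
  rw [fourier_apply, Circle.norm_coe]

theorem torusRotate_mem {n : ℕ} {Ω : Set (Fin n → ℂ)} (hΩ : IsReinhardt Ω)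
    (x : UnitAddTorus (Fin n)) {z : Fin n → ℂ} (hz : z ∈ Ω) : torusRotate x z ∈ Ω :=
  hΩ z hz _ fun j => norm_fourier_apply 1 (x j)

theorem torusRotate_add {n : ℕ} (x y : UnitAddTorus (Fin n)) (z : Fin n → ℂ) :
    torusRotate (x + y) z = torusRotate x (torusRotate y z) := by
  ext j
  simp only [torusRotate, Pi.add_apply, fourier_apply, one_smul, AddCircle.toCircle_add,
    Circle.coe_mul, mul_assoc]

theorem torusRotate_zero {n : ℕ} (z : Fin n → ℂ) : torusRotate 0 z = z := by
  ext j
  simp [torusRotate]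

theorem torusRotate_add_smul {n : ℕ} (x : UnitAddTorus (Fin n)) (z v : Fin n → ℂ) (l : ℂ) :
    torusRotate x (z + l • v) = torusRotate x z + l • torusRotate x v := by
  ext j
  simp only [torusRotate, Pi.add_apply, Pi.smul_apply, smul_eq_mul]
  ring

theorem measurePreserving_mul_of_norm_eq_one {n : ℕ} (u : Fin n → ℂ) (hu : ∀ j, ‖u j‖ = 1) :
    MeasurePreserving (fun z : Fin n → ℂ => fun j => u j * z j) volume volume := by
  refine volume_preserving_pi (f := fun j (w : ℂ) => u j * w) fun j => ?_
  have := (rotation ⟨u j, mem_sphere_zero_iff_norm.2 (hu j)⟩).measurePreserving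
  exact this

/-- The Fourier coefficients of `F` along the orbits of the torus. -/
noncomputable def torusCoeff {n : ℕ} (F : (Fin n → ℂ) → ℂ) (a : Fin n → ℤ) (z : Fin n → ℂ) : ℂ :=
  ∫ x, UnitAddTorus.mFourier (-a) x * F (torusRotate x z) ∂torusHaar n

theorem torusCoeff_torusRotate {n : ℕ} (F : (Fin n → ℂ) → ℂ) (a : Fin n → ℤ)
    (y : UnitAddTorus (Fin n)) (z : Fin n → ℂ) :
    torusCoeff F a (torusRotate y z) = UnitAddTorus.mFourier a y * torusCoeff F a z := by
  unfold torusCoeff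
  rw [← integral_const_mul, ← integral_add_right_eq_self
    (fun x => UnitAddTorus.mFourier a y * (UnitAddTorus.mFourier (-a) x * F (torusRotate x z))) y]
  refine integral_congr_ae (Filter.Eventually.of_forall fun x => ?_)
  have e : ∀ b : Fin n → ℤ, UnitAddTorus.mFourier b (x + y) =
      UnitAddTorus.mFourier b x * UnitAddTorus.mFourier b y := fun b => by
    simp only [UnitAddTorus.mFourier, ContinuousMap.coe_mk, Pi.add_apply, fourier_apply,
      smul_add, AddCircle.toCircle_add, Circle.coe_mul, Finset.prod_mul_distrib]
  have e' : UnitAddTorus.mFourier a y * UnitAddTorus.mFourier (-a) y = 1 := by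
    rw [← UnitAddTorus.mFourier_add, add_neg_cancel, UnitAddTorus.mFourier_zero]
    rfl
  simp only [e, torusRotate_add]
  linear_combination (-UnitAddTorus.mFourier (-a) x * F (torusRotate x (torusRotate y z))) * e'

theorem continuousOn_torusRotate {n : ℕ} {Ω : Set (Fin n → ℂ)} (hΩ : IsReinhardt Ω)
    {F : (Fin n → ℂ) → ℂ} (hF : ContinuousOn F Ω) {z : Fin n → ℂ} (hz : z ∈ Ω) :
    Continuous fun x => F (torusRotate x z) :=
  hF.comp_continuous (continuous_torusRotate.comp (by fun_prop :
    Continuous fun x : UnitAddTorus (Fin n) => (x, z))) fun x => torusRotate_mem hΩ x hz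

theorem isLineHolomorphicOn_torusCoeff {n : ℕ} {Ω : Set (Fin n → ℂ)} (hO : IsOpen Ω)
    (hΩ : IsReinhardt Ω) {F : (Fin n → ℂ) → ℂ} (hF : DifferentiableOn ℂ F Ω) (a : Fin n → ℤ) :
    IsLineHolomorphicOn (torusCoeff F a) Ω := by
  intro z v
  refine differentiableOn_integral_of_compactSpace (torusHaar n)
    (H := fun l x => UnitAddTorus.mFourier (-a) x * F (torusRotate x (z + l • v)))
    (hO.preimage (by fun_prop : Continuous fun l : ℂ => z + l • v)) ?_ fun x => ?_
  · have h1 : Continuous fun p : ℂ × UnitAddTorus (Fin n) => torusRotate p.2 (z + p.1 • v) :=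
      continuous_torusRotate.comp (by fun_prop : Continuous fun p : ℂ × UnitAddTorus (Fin n) =>
        (p.2, z + p.1 • v))
    refine ContinuousOn.mul (by fun_prop) (hF.continuousOn.comp h1.continuousOn ?_)
    rintro ⟨l, x⟩ ⟨hl, -⟩
    exact torusRotate_mem hΩ x hl
  · refine DifferentiableOn.const_mul ?_ _
    refine hF.comp (f := fun l : ℂ => torusRotate x (z + l • v)) ?_ fun l hl =>
      torusRotate_mem hΩ x hl
    simp only [torusRotate_add_smul]
    fun_prop

/-- A function on a Reinhardt domain is determined by its torus coefficients. -/
theorem eq_sum_torusCoeff {n : ℕ} {Ω : Set (Fin n → ℂ)} (hΩ : IsReinhardt Ω)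
    {F : (Fin n → ℂ) → ℂ} (hF : ContinuousOn F Ω) (s : Finset (Fin n → ℤ)) {z : Fin n → ℂ}
    (hz : z ∈ Ω) (h0 : ∀ a ∉ s, torusCoeff F a z = 0) :
    F z = ∑ a ∈ s, torusCoeff F a z := by
  let f : C(UnitAddTorus (Fin n), ℂ) := ⟨_, continuousOn_torusRotate hΩ hF hz⟩
  have hf : ∀ a, UnitAddTorus.mFourierCoeff f a = torusCoeff F a z := fun a => rfl
  have hs : Summable (UnitAddTorus.mFourierCoeff f) :=
    summable_of_ne_finset_zero (s := s) fun a ha => by rw [hf, h0 a ha]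
  -- With summable coefficients the Fourier series of the orbit function converges pointwise; the
  -- point `0` of the torus gives back `F z`.
  have h := UnitAddTorus.hasSum_mFourier_series_apply_of_summable hs 0
  have h' := h.unique (hasSum_sum_of_ne_finset_zero (s := s) fun a ha => by
    rw [hf, h0 a ha, zero_smul])
  have hf0 : f 0 = F z := congrArg F (torusRotate_zero z)
  rw [← hf0, h']
  refine Finset.sum_congr rfl fun a _ => ?_
  simp [hf, UnitAddTorus.mFourier]

/-- On each orbit the coefficient is bounded by the L¹ norm, hence by the L² norm as the torus has
mass one. Integrating over `Ω`, Tonelli and the rotation invariance of Lebesgue measure and of `Ω`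
remove the average. -/
theorem lintegral_torusCoeff_le {n : ℕ} {Ω : Set (Fin n → ℂ)} (hO : IsOpen Ω)
    (hΩ : IsReinhardt Ω) {F : (Fin n → ℂ) → ℂ} (hF : ContinuousOn F Ω) (a : Fin n → ℤ) :
    ∫⁻ z in Ω, ‖torusCoeff F a z‖ₑ ^ 2 ≤ ∫⁻ z in Ω, ‖F z‖ₑ ^ 2 := by
  have hmeas : Measurable (Ω.indicator fun z => ‖F z‖ₑ ^ 2) := by
    have : Measurable (Ω.indicator F) := by
      classical
      rw [← Set.piecewise_eq_indicator]
      exact hF.measurable_piecewise continuous_zero.continuousOn hO.measurableSet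
    have h2 : (Ω.indicator fun z => ‖F z‖ₑ ^ 2) = fun z => ‖Ω.indicator F z‖ₑ ^ 2 := by
      ext z
      by_cases hz : z ∈ Ω <;> simp [hz]
    rw [h2]
    fun_prop
  have hle : ∀ z ∈ Ω, ‖torusCoeff F a z‖ₑ ^ 2 ≤
      ∫⁻ x, (Ω.indicator fun z => ‖F z‖ₑ ^ 2) (torusRotate x z) ∂torusHaar n := by
    intro z hz
    have hc := continuousOn_torusRotate hΩ hF hz
    have h1 : ‖torusCoeff F a z‖ₑ ≤ eLpNorm (fun x => F (torusRotate x z)) 1 (torusHaar n) := by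
      refine (enorm_integral_le_lintegral_enorm _).trans ?_
      rw [eLpNorm_one_eq_lintegral_enorm]
      refine lintegral_mono fun x => ?_
      rw [enorm_mul]
      have : ‖UnitAddTorus.mFourier (-a) x‖ₑ ≤ 1 := by
        rw [← ofReal_norm, ← ENNReal.ofReal_one]
        exact ENNReal.ofReal_le_ofReal
          ((ContinuousMap.norm_coe_le_norm _ x).trans_eq UnitAddTorus.mFourier_norm)
      exact mul_le_of_le_one_left' this
    have h2 := h1.trans (eLpNorm_le_eLpNorm_of_exponent_le (q := 2) (by norm_num)
      hc.aestronglyMeasurable)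
    calc ‖torusCoeff F a z‖ₑ ^ 2 ≤ eLpNorm (fun x => F (torusRotate x z)) 2 (torusHaar n) ^ 2 := by
          gcongr
      _ = ∫⁻ x, ‖F (torusRotate x z)‖ₑ ^ 2 ∂torusHaar n := by
          rw [eLpNorm_eq_lintegral_rpow_enorm_toReal (by norm_num) (by norm_num)]
          rw [← ENNReal.rpow_natCast, ← ENNReal.rpow_mul]
          simp
      _ = _ := by
          refine lintegral_congr fun x => ?_
          rw [Set.indicator_of_mem (torusRotate_mem hΩ x hz)]
  calc ∫⁻ z in Ω, ‖torusCoeff F a z‖ₑ ^ 2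
      ≤ ∫⁻ z in Ω, ∫⁻ x, (Ω.indicator fun z => ‖F z‖ₑ ^ 2) (torusRotate x z) ∂torusHaar n :=
        setLIntegral_mono' hO.measurableSet hle
    _ ≤ ∫⁻ z, ∫⁻ x, (Ω.indicator fun z => ‖F z‖ₑ ^ 2) (torusRotate x z) ∂torusHaar n :=
        setLIntegral_le_lintegral _ _
    _ = ∫⁻ x, ∫⁻ z, (Ω.indicator fun z => ‖F z‖ₑ ^ 2) (torusRotate x z) ∂volume ∂torusHaar n := by
        refine lintegral_lintegral_swap ?_
        exact (hmeas.comp (continuous_torusRotate.comp continuous_swap).measurable).aemeasurable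
    _ = ∫⁻ x, ∫⁻ z, (Ω.indicator fun z => ‖F z‖ₑ ^ 2) z ∂volume ∂torusHaar n := by
        refine lintegral_congr fun x => ?_
        exact (measurePreserving_mul_of_norm_eq_one _ fun j =>
          norm_fourier_apply 1 (x j)).lintegral_comp hmeas
    _ = ∫⁻ z in Ω, ‖F z‖ₑ ^ 2 := by
        rw [lintegral_const, measure_univ, mul_one, lintegral_indicator hO.measurableSet]

/-! ### Equivariant holomorphic functions near the origin are monomials -/

theorem exists_toCircle_eq (u : ℂ) (hu : ‖u‖ = 1) :
    ∃ θ : UnitAddCircle, (AddCircle.toCircle θ : ℂ) = u := by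
  obtain ⟨θ, hθ⟩ := (AddCircle.homeomorphCircle (T := 1) one_ne_zero).surjective
    ⟨u, mem_sphere_zero_iff_norm.2 hu⟩
  refine ⟨θ, ?_⟩
  rw [AddCircle.homeomorphCircle_apply] at hθ
  rw [hθ]

/-- A torus-equivariant function transforms in each variable by a character of the circle. -/
theorem apply_update_of_equivariant {n : ℕ} {g : (Fin n → ℂ) → ℂ} {a : Fin n → ℤ}
    {Ω : Set (Fin n → ℂ)}
    (he : ∀ z ∈ Ω, ∀ y, g (torusRotate y z) = UnitAddTorus.mFourier a y * g z)
    {z : Fin n → ℂ} (hz : z ∈ Ω) (j : Fin n) {u : ℂ} (hu : ‖u‖ = 1) :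
    g (Function.update z j (u * z j)) = u ^ a j * g z := by
  obtain ⟨θ, hθ⟩ := exists_toCircle_eq u hu
  have h1 : torusRotate (Pi.single j θ) z = Function.update z j (u * z j) := by
    ext i
    rcases eq_or_ne i j with rfl | hij
    · simp [torusRotate, hθ]
    · simp [torusRotate, hij]
  have h2 : UnitAddTorus.mFourier a (Pi.single j θ) = u ^ a j := by
    simp only [UnitAddTorus.mFourier, ContinuousMap.coe_mk]
    rw [Finset.prod_eq_single j]
    · rw [Pi.single_eq_same, fourier_apply, AddCircle.toCircle_zsmul, Circle.coe_zpow, hθ]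
    · intro i _ hij
      rw [Pi.single_eq_of_ne hij, fourier_eval_zero]
    · simp
  rw [← h1, ← h2, he z hz]

section Equivariant

variable {n : ℕ} {g : (Fin n → ℂ) → ℂ} {a : Fin n → ℤ} {r : ℝ}

/-- The norm is the sup norm, so balls about the origin are polydiscs and survive the contraction of
a single coordinate. -/
theorem update_mem_ball {z : Fin n → ℂ} (hz : z ∈ Metric.ball (0 : Fin n → ℂ) r) (j : Fin n)
    {u : ℂ} (hu : ‖u‖ ≤ 1) : Function.update z j (u * z j) ∈ Metric.ball (0 : Fin n → ℂ) r := by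
  have hr : 0 < r := (norm_nonneg z).trans_lt (mem_ball_zero_iff.1 hz)
  rw [mem_ball_zero_iff, pi_norm_lt_iff hr] at hz ⊢
  intro i
  rcases eq_or_ne i j with rfl | hij
  · rw [Function.update_self, norm_mul]
    exact (mul_le_of_le_one_left (norm_nonneg _) hu).trans_lt (hz i)
  · rw [Function.update_of_ne hij]
    exact hz i

theorem diffContOnCl_update (hg : IsLineHolomorphicOn g (Metric.ball 0 r)) {z : Fin n → ℂ}
    (hz : z ∈ Metric.ball (0 : Fin n → ℂ) r) (j : Fin n) :
    DiffContOnCl ℂ (fun l : ℂ => g (Function.update z j (l * z j))) (Metric.ball 0 1) := by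
  apply DifferentiableOn.diffContOnCl
  have e : ∀ l : ℂ, Function.update z j (l * z j) =
      Function.update z j 0 + l • (Pi.single j (z j) : Fin n → ℂ) := by
    intro l
    ext i
    rcases eq_or_ne i j with rfl | hij
    · simp
    · simp [hij]
  simp only [e]
  refine (hg (Function.update z j 0) (Pi.single j (z j))).mono fun l hl => ?_
  rw [closure_ball _ one_ne_zero, mem_closedBall_zero_iff] at hl
  rw [Set.mem_ofPred_eq, ← e]
  exact update_mem_ball hz j hl

/-- Both sides are holomorphic in `l` on the unit disc and agree on its boundary circle by
equivariance. -/
theorem eqOn_update_of_nonneg (hg : IsLineHolomorphicOn g (Metric.ball 0 r))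
    (he : ∀ z ∈ Metric.ball (0 : Fin n → ℂ) r, ∀ y,
      g (torusRotate y z) = UnitAddTorus.mFourier a y * g z)
    {z : Fin n → ℂ} (hz : z ∈ Metric.ball (0 : Fin n → ℂ) r) (j : Fin n) (ha : 0 ≤ a j) {l : ℂ}
    (hl : ‖l‖ ≤ 1) : g (Function.update z j (l * z j)) = l ^ (a j).toNat * g z := by
  have := Complex.eqOn_closure_of_eqOn_frontier (g := fun l : ℂ => l ^ (a j).toNat * g z)
    Metric.isBounded_ball (diffContOnCl_update hg hz j)
    (Differentiable.diffContOnCl (by fun_prop)) (fun u hu => ?_)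
  · refine this ?_
    rwa [closure_ball _ one_ne_zero, mem_closedBall_zero_iff]
  · rw [frontier_ball _ one_ne_zero, mem_sphere_zero_iff_norm] at hu
    simp only
    rw [apply_update_of_equivariant he hz j hu]
    nth_rw 1 [← Int.toNat_of_nonneg ha]
    rw [zpow_natCast]

/-- The function `l ^ (-a j) * g (…, l * z j, …)` is holomorphic on the disc and equals the constant
`g z` on the circle, hence also at `l = 0`, where it vanishes. -/
theorem eq_zero_of_equivariant_of_neg (hg : IsLineHolomorphicOn g (Metric.ball 0 r))
    (he : ∀ z ∈ Metric.ball (0 : Fin n → ℂ) r, ∀ y,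
      g (torusRotate y z) = UnitAddTorus.mFourier a y * g z)
    {z : Fin n → ℂ} (hz : z ∈ Metric.ball (0 : Fin n → ℂ) r) (j : Fin n) (ha : a j < 0) :
    g z = 0 := by
  have := Complex.eqOn_closure_of_eqOn_frontier (g := fun _ : ℂ => g z)
    (f := fun l : ℂ => l ^ (-a j).toNat • g (Function.update z j (l * z j)))
    Metric.isBounded_ball (DiffContOnCl.smul (Differentiable.diffContOnCl (by fun_prop))
      (diffContOnCl_update hg hz j))
    diffContOnCl_const (fun u hu => ?_)
  · have h0 := this (x := 0) (by simp [closure_ball])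
    have hne : (-a j).toNat ≠ 0 := by omega
    simpa [hne] using h0.symm
  · rw [frontier_ball _ one_ne_zero, mem_sphere_zero_iff_norm] at hu
    simp only
    have hu0 : u ≠ 0 := fun h => by simp [h] at hu
    rw [apply_update_of_equivariant he hz j hu, smul_eq_mul, ← mul_assoc, ← zpow_natCast,
      Int.toNat_of_nonneg (by omega), ← zpow_add₀ hu0]
    simp

/-- Every `z` in the polydisc of radius `r / 2` arises from `(r/2, …, r/2)` by multiplying the
coordinates one after another by `2 zⱼ / r`, which have modulus at most one. Each multiplication
contributes one power. -/
theorem eq_monomial_of_equivariant (hr : 0 < r) (hg : IsLineHolomorphicOn g (Metric.ball 0 r))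
    (he : ∀ z ∈ Metric.ball (0 : Fin n → ℂ) r, ∀ y,
      g (torusRotate y z) = UnitAddTorus.mFourier a y * g z) (ha : ∀ j, 0 ≤ a j) :
    ∃ c : ℂ, ∀ z ∈ Metric.ball (0 : Fin n → ℂ) (r / 2), g z = c * ∏ j, z j ^ (a j).toNat := by
  have hp : ∀ (l : Fin n → ℂ), (∀ j, ‖l j‖ ≤ 1) → ∀ s : Finset (Fin n),
      g (fun j => if j ∈ s then l j * (r / 2 : ℝ) else (r / 2 : ℝ)) =
        (∏ j ∈ s, l j ^ (a j).toNat) * g (fun _ => (r / 2 : ℝ)) := by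
    intro l hl s
    induction s using Finset.induction_on with
    | empty => simp
    | insert j s hj ih =>
      have hmem : (fun i => if i ∈ s then l i * (r / 2 : ℝ) else ((r / 2 : ℝ) : ℂ)) ∈
          Metric.ball (0 : Fin n → ℂ) r := by
        rw [mem_ball_zero_iff, pi_norm_lt_iff hr]
        intro i
        have h2 : ‖((r / 2 : ℝ) : ℂ)‖ = r / 2 := by
          rw [Complex.norm_real, Real.norm_of_nonneg (by linarith)]
        split_ifs
        · rw [norm_mul, h2]
          nlinarith [hl i]
        · rw [h2]; linarith
      have h := eqOn_update_of_nonneg hg he hmem j (ha j) (hl j)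
      rw [ih, ← mul_assoc, ← Finset.prod_insert (f := fun j => l j ^ (a j).toNat) hj] at h
      rw [← h]
      congr 1
      ext i
      rcases eq_or_ne i j with rfl | hij
      · simp [hj]
      · simp [hij]
  refine ⟨(∏ j, ((2 / r : ℝ) : ℂ) ^ (a j).toNat) * g (fun _ => (r / 2 : ℝ)), fun z hz => ?_⟩
  rw [mem_ball_zero_iff, pi_norm_lt_iff (half_pos hr)] at hz
  have h := hp (fun j => ((2 / r : ℝ) : ℂ) * z j) (fun j => ?_) Finset.univ
  · have e : (fun j => if j ∈ Finset.univ then ((2 / r : ℝ) : ℂ) * z j * (r / 2 : ℝ)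
        else ((r / 2 : ℝ) : ℂ)) = z := by
      ext j
      have : ((2 / r : ℝ) : ℂ) * (r / 2 : ℝ) = 1 := by
        rw [← Complex.ofReal_mul]
        field_simp
        simp
      simp only [Finset.mem_univ, if_true]
      linear_combination (z j) * this
    rw [e] at h
    rw [h]
    simp only [mul_pow, Finset.prod_mul_distrib]
    ring
  · rw [norm_mul, Complex.norm_real, Real.norm_of_nonneg (by positivity)]
    have := (hz j).le
    calc 2 / r * ‖z j‖ ≤ 2 / r * (r / 2) := by gcongr
      _ = 1 := by field_simp

end Equivariant

theorem differentiable_monomial {n : ℕ} (a : Fin n → ℕ) :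
    Differentiable ℂ fun z : Fin n → ℂ => ∏ j, z j ^ a j := by
  induction (Finset.univ : Finset (Fin n)) using Finset.induction_on with
  | empty => simp
  | insert j s hj ih =>
    simp only [Finset.prod_insert hj]
    exact Differentiable.mul (by fun_prop) ih

/-- On a Reinhardt domain that contains the origin, the torus coefficients of a holomorphic
function are monomials. -/
theorem torusCoeff_eq_monomial {n : ℕ} {Ω : Set (Fin n → ℂ)} (hO : IsOpen Ω)
    (hc : IsPreconnected Ω) (hΩ : IsReinhardt Ω) (h0 : (0 : Fin n → ℂ) ∈ Ω)
    {F : (Fin n → ℂ) → ℂ} (hF : DifferentiableOn ℂ F Ω) (b : Fin n → ℤ) :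
    (∃ j, b j < 0) ∧ (∀ z ∈ Ω, torusCoeff F b z = 0) ∨
      (∀ j, 0 ≤ b j) ∧ ∃ c : ℂ, ∀ z ∈ Ω, torusCoeff F b z = c * ∏ j, z j ^ (b j).toNat := by
  obtain ⟨r, hr, hrΩ⟩ := Metric.isOpen_iff.1 hO 0 h0
  have hg := isLineHolomorphicOn_torusCoeff hO hΩ hF b
  have hgr : IsLineHolomorphicOn (torusCoeff F b) (Metric.ball 0 r) := fun z v =>
    (hg z v).mono fun l hl => hrΩ hl
  have he : ∀ z ∈ Metric.ball (0 : Fin n → ℂ) r, ∀ y,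
      torusCoeff F b (torusRotate y z) = UnitAddTorus.mFourier b y * torusCoeff F b z :=
    fun z _ y => torusCoeff_torusRotate F b y z
  by_cases hb : ∃ j, b j < 0
  · left
    obtain ⟨j, hj⟩ := hb
    refine ⟨⟨j, hj⟩, hg.eqOn_zero hO hc h0 ?_⟩
    filter_upwards [Metric.ball_mem_nhds _ hr] with z hz
    exact eq_zero_of_equivariant_of_neg hgr he hz j hj
  · right
    push Not at hb
    obtain ⟨c, hc'⟩ := eq_monomial_of_equivariant hr hgr he hb
    have hd : DifferentiableOn ℂ (fun z : Fin n → ℂ => c * ∏ j, z j ^ (b j).toNat) Ω :=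
      ((differentiable_monomial fun j => (b j).toNat).const_mul c).differentiableOn
    refine ⟨hb, c, fun z hz => sub_eq_zero.1 ?_⟩
    refine (hg.sub hd.isLineHolomorphicOn).eqOn_zero hO hc h0 ?_ z hz
    filter_upwards [Metric.ball_mem_nhds _ (half_pos hr)] with z hz
    rw [hc' z hz, sub_self]

/-! ### The Bergman space of a Reinhardt domain containing the origin -/

theorem lintegral_lebesgueOn {n : ℕ} {Ω : Set (Fin n → ℂ)} (hO : IsOpen Ω)
    (F : (Fin n → ℂ) → ENNReal) : ∫⁻ z : Ω, F z ∂lebesgueOn Ω = ∫⁻ z in Ω, F z :=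
  lintegral_subtype_comap hO.measurableSet F

theorem integral_lebesgueOn {n : ℕ} {Ω : Set (Fin n → ℂ)} (hO : IsOpen Ω)
    (F : (Fin n → ℂ) → ℂ) : ∫ z : Ω, F z ∂lebesgueOn Ω = ∫ z in Ω, F z :=
  integral_subtype_comap hO.measurableSet F

theorem eLpNorm_two_lt_top_iff {X : Type*} [MeasurableSpace X] {μ : Measure X} (f : X → ℂ) :
    eLpNorm f 2 μ < ⊤ ↔ ∫⁻ x, ‖f x‖ₑ ^ 2 ∂μ < ⊤ := by
  rw [eLpNorm_lt_top_iff_lintegral_rpow_enorm_lt_top (by norm_num) (by norm_num)]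
  simp

theorem mem_bergmanSpace_iff {n : ℕ} {Ω : Set (Fin n → ℂ)} (hO : IsOpen Ω)
    {F : (Fin n → ℂ) → ℂ} (hF : DifferentiableOn ℂ F Ω) {f : Ω → ℂ} (hf : ∀ z : Ω, F z = f z) :
    f ∈ bergmanSpace Ω ↔ ∫⁻ z in Ω, ‖F z‖ₑ ^ 2 < ⊤ := by
  have hfc : Continuous f := by
    have := continuousOn_iff_continuous_domRestrict.1 hF.continuousOn
    convert this using 1
    ext z
    exact (hf z).symm
  have h1 : f ∈ bergmanSpace Ω ↔ IsHolomorphicOn Ω f ∧ MemLp f 2 (lebesgueOn Ω) := Iff.rfl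
  have h2 : ∫⁻ z : Ω, ‖f z‖ₑ ^ 2 ∂lebesgueOn Ω = ∫⁻ z in Ω, ‖F z‖ₑ ^ 2 := by
    rw [← lintegral_lebesgueOn hO]
    simp only [hf]
  rw [h1, ← h2, ← eLpNorm_two_lt_top_iff]
  exact ⟨fun h => h.2.2, fun h => ⟨⟨F, hF, hf⟩, hfc.aestronglyMeasurable, h⟩⟩

/-- Only square-integrable monomials can occur in the expansion of an element of `A²(Ω)`, because
taking a torus coefficient does not increase the L² norm. -/
theorem lintegral_monomial_lt_top_of_torusCoeff {n : ℕ} {Ω : Set (Fin n → ℂ)} (hO : IsOpen Ω)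
    (hΩ : IsReinhardt Ω) {F : (Fin n → ℂ) → ℂ} (hF : DifferentiableOn ℂ F Ω)
    (hfin : ∫⁻ z in Ω, ‖F z‖ₑ ^ 2 < ⊤) {b : Fin n → ℤ} {α : Fin n → ℕ} {c : ℂ} (hc : c ≠ 0)
    (h : ∀ z ∈ Ω, torusCoeff F b z = c * ∏ j, z j ^ α j) :
    ∫⁻ z in Ω, ‖∏ j, z j ^ α j‖ₑ ^ 2 < ⊤ := by
  have h1 := (lintegral_torusCoeff_le hO hΩ hF.continuousOn b).trans_lt hfin
  rw [setLIntegral_congr_fun (g := fun z => ‖c‖ₑ ^ 2 * ‖∏ j, z j ^ α j‖ₑ ^ 2) hO.measurableSet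
    (fun z hz => by simp only [h z hz, enorm_mul, mul_pow]),
    lintegral_const_mul' _ _ (by simp)] at h1
  refine ENNReal.lt_top_of_mul_ne_top_right h1.ne ?_
  simpa using hc

/-- The Bergman space of a Reinhardt domain that contains the origin is spanned by the
square-integrable monomials, if these are the monomials of degree at most `m`. -/
theorem bergmanSpace_eq_span_monomials {n m : ℕ} {Ω : Set (Fin n → ℂ)} (hO : IsOpen Ω)
    (hc : IsPreconnected Ω) (hΩ : IsReinhardt Ω) (h0 : (0 : Fin n → ℂ) ∈ Ω)
    (hfin : ∀ α : Fin n → ℕ, ∑ j, α j ≤ m → ∫⁻ z in Ω, ‖∏ j, z j ^ α j‖ₑ ^ 2 < ⊤)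
    (hinf : ∀ α : Fin n → ℕ, m < ∑ j, α j → ∫⁻ z in Ω, ‖∏ j, z j ^ α j‖ₑ ^ 2 = ⊤) :
    bergmanSpace Ω =
      Submodule.span ℂ {f : Ω → ℂ | ∃ α : Fin n → ℕ, ∑ j, α j ≤ m ∧ f = monomialOn Ω α} := by
  apply le_antisymm
  · intro f hf
    obtain ⟨F, hF, hFf⟩ := hf.1
    have hF2 := (mem_bergmanSpace_iff hO hF hFf).1 hf
    have key : ∀ b : Fin n → ℤ, ∃ c : ℂ,
        (¬ ((∀ j, 0 ≤ b j) ∧ ∑ j, (b j).toNat ≤ m) → c = 0) ∧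
        ∀ z ∈ Ω, torusCoeff F b z = c * ∏ j, z j ^ (b j).toNat := by
      intro b
      rcases torusCoeff_eq_monomial hO hc hΩ h0 hF b with ⟨-, h⟩ | ⟨hb, c, h⟩
      · exact ⟨0, fun _ => rfl, fun z hz => by rw [h z hz, zero_mul]⟩
      · refine ⟨c, fun hn => ?_, h⟩
        by_contra hc0
        have := lintegral_monomial_lt_top_of_torusCoeff hO hΩ hF hF2 hc0 h
        rw [hinf _ (not_le.1 fun h => hn ⟨hb, h⟩)] at this
        exact this.ne rfl
    choose c hc0 hcz using key
    -- The box `[0, m]ⁿ` is merely a convenient finite set containing all exponents with a non-zero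
    -- coefficient; `c` vanishes on its superfluous members.
    let s : Finset (Fin n → ℤ) := Fintype.piFinset fun _ => Finset.Icc 0 (m : ℤ)
    have hs : ∀ b ∉ s, c b = 0 := by
      intro b hb
      refine hc0 b fun hb' => hb (Fintype.mem_piFinset.2 fun j => Finset.mem_Icc.2 ⟨hb'.1 j, ?_⟩)
      have := Finset.single_le_sum (f := fun j => (b j).toNat) (fun _ _ => Nat.zero_le _)
        (Finset.mem_univ j)
      have h2 := hb'.1 j
      have h3 := hb'.2
      omega
    have hfs : f = ∑ b ∈ s, c b • monomialOn Ω fun j => (b j).toNat := by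
      ext z
      rw [← hFf z, eq_sum_torusCoeff hΩ hF.continuousOn s z.2 fun b hb => by
        rw [hcz b z z.2, hs b hb, zero_mul]]
      rw [Finset.sum_apply]
      exact Finset.sum_congr rfl fun b _ => by rw [hcz b z z.2]; rfl
    rw [hfs]
    refine Submodule.sum_mem _ fun b _ => ?_
    by_cases hb : (∀ j, 0 ≤ b j) ∧ ∑ j, (b j).toNat ≤ m
    · exact Submodule.smul_mem _ _ (Submodule.subset_span ⟨_, hb.2, rfl⟩)
    · rw [hc0 b hb, zero_smul]
      exact Submodule.zero_mem _
  · refine Submodule.span_le.2 ?_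
    rintro f ⟨α, hα, rfl⟩
    exact (mem_bergmanSpace_iff hO (differentiable_monomial α).differentiableOn
      fun _ => rfl).2 (hfin α hα)

/-! ### Convex separation and positive cubature -/

open Pointwise in
/-- A point of a finite-dimensional space that every non-zero functional which is non-positive on
the family `e` sends to a negative number is a positive combination of finitely many members of
`e` that span the space. -/
theorem exists_finsupp_linearCombination_eq {ι V : Type*} [NormedAddCommGroup V]
    [NormedSpace ℝ V] [FiniteDimensional ℝ V] (e : ι → V) (c : V)
    (h : ∀ f : V →L[ℝ] ℝ, (∀ i, f (e i) ≤ 0) → 0 ≤ f c → f = 0) :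
    ∃ x : ι →₀ ℝ, (∀ i, 0 ≤ x i) ∧ Finsupp.linearCombination ℝ e x = c ∧
      Submodule.span ℝ (e '' x.support) = ⊤ := by
  classical
  have hspan : Submodule.span ℝ (Set.range e) = ⊤ := by
    by_contra hne
    obtain ⟨f, hf0, hf⟩ := Submodule.exists_le_ker_of_lt_top _ (lt_top_iff_ne_top.2 hne)
    have hfe : ∀ i, f (e i) = 0 := fun i => hf (Submodule.subset_span ⟨i, rfl⟩)
    let g : V →L[ℝ] ℝ := LinearMap.toContinuousLinearMap f
    have hg : ∀ v, g v = f v := fun v => rfl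
    refine hf0 (LinearMap.ext fun v => ?_)
    rcases le_total 0 (f c) with hc | hc
    · rw [← hg, h g (fun i => by rw [hg, hfe i]) (by rwa [hg])]
      rfl
    · have := h (-g) (fun i => by simp [hg, hfe i]) (by simpa [hg] using hc)
      rw [← hg, neg_eq_zero.1 this]
      rfl
  obtain ⟨κ, a, hainj, haspan, hali⟩ := exists_linearIndependent' ℝ e
  have : Finite κ := hali.finite
  have := Fintype.ofFinite κ
  let B : Module.Basis κ ℝ V := Module.Basis.mk hali (by rw [haspan, hspan])
  have hB : ∀ k, B k = e (a k) := fun k => Module.Basis.mk_apply _ _ k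
  -- The open simplicial cone of a basis chosen from `e`. Its sum with the cone `K` generated by `e`
  -- is open, so `c` can be separated strictly from it, and a point of `U` has positive weight on
  -- every basis vector.
  let U : Set V := {v | ∀ k, 0 < B.equivFun v k}
  have hBc : Continuous fun v => B.equivFun v :=
    LinearMap.continuous_of_finiteDimensional B.equivFun.toLinearMap
  have hUo : IsOpen U := by
    have : U = ⋂ k, {v | 0 < B.equivFun v k} := by ext; simp [U]
    rw [this]
    exact isOpen_iInter_of_finite fun k =>
      isOpen_lt continuous_const ((continuous_apply k).comp hBc)
  let u₀ : V := ∑ k, B k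
  have hu₀ : ∀ k, B.equivFun u₀ k = 1 := fun k => by
    simp [u₀, Finsupp.single_apply]
  let K : Set V := {v | ∃ x : ι →₀ ℝ, (∀ i, 0 ≤ x i) ∧ Finsupp.linearCombination ℝ e x = v}
  have hUc : Convex ℝ U := by
    intro v hv w hw s t hs ht hst k
    rw [map_add, map_smul, map_smul]
    simp only [Pi.add_apply, Pi.smul_apply, smul_eq_mul]
    rcases hs.eq_or_lt with rfl | hs
    · rw [zero_add] at hst
      simpa [hst] using hw k
    · have := mul_pos hs (hv k)
      have := mul_nonneg ht (hw k).le
      linarith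
  have hKc : Convex ℝ K := by
    rintro _ ⟨x, hx, rfl⟩ _ ⟨y, hy, rfl⟩ s t hs ht -
    refine ⟨s • x + t • y, fun i => ?_, by simp⟩
    have := mul_nonneg hs (hx i)
    have := mul_nonneg ht (hy i)
    simp only [Finsupp.add_apply, Finsupp.smul_apply, smul_eq_mul]
    linarith
  have hmem : c ∈ U + K := by
    by_contra hc
    obtain ⟨f, hf⟩ := geometric_hahn_banach_open_point (hUc.add hKc) hUo.add_right hc
    -- A bound along a ray: `t → ∞` controls the slope, `t → 0` the starting point.
    have hlin : ∀ r s : ℝ, (∀ t : ℝ, 0 < t → r + t * s < f c) → s ≤ 0 ∧ r ≤ f c := by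
      intro r s hrs
      constructor
      · by_contra hs
        push Not at hs
        have := hrs ((|f c - r| + 1) / s) (by positivity)
        rw [div_mul_cancel₀ _ hs.ne'] at this
        have := le_abs_self (f c - r)
        linarith
      · refine le_of_forall_pos_lt_add fun δ hδ => ?_
        have hp : 0 < δ / (|s| + 1) := by positivity
        have h1 := hrs _ hp
        have h2 : -(δ / (|s| + 1) * s) < δ := by
          have h3 : δ / (|s| + 1) * (-s) ≤ δ / (|s| + 1) * |s| := by
            gcongr
            exact neg_le_abs s
          have h4 : δ / (|s| + 1) * |s| < δ := by
            rw [div_mul_eq_mul_div, div_lt_iff₀ (by positivity)]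
            nlinarith
          linarith
        linarith
    have h1 : ∀ i, f (e i) ≤ 0 := by
      intro i
      refine (hlin (f u₀) _ fun t ht => ?_).1
      have := hf (u₀ + t • e i) (Set.add_mem_add (fun k => by rw [hu₀]; exact one_pos)
        ⟨Finsupp.single i t, fun j => by
          rw [Finsupp.single_apply]; split_ifs <;> linarith, by simp⟩)
      simpa using this
    have h2 : 0 ≤ f c := by
      refine (hlin 0 (f u₀) fun t ht => ?_).2
      have := hf (t • u₀ + 0) (Set.add_mem_add (fun k => by
        rw [map_smul, Pi.smul_apply, hu₀, smul_eq_mul, mul_one]; exact ht)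
        ⟨0, fun _ => le_rfl, by simp⟩)
      simpa using this
    have h3 := hf (u₀ + 0) (Set.add_mem_add (fun k => by rw [hu₀]; exact one_pos)
      ⟨0, fun _ => le_rfl, by simp⟩)
    rw [h f h1 h2] at h3
    simp at h3
  obtain ⟨u, hu, v, ⟨y, hy, rfl⟩, rfl⟩ := hmem
  -- The weights of the part in `U`. They are positive on the basis, and adding the non-negative `y`
  -- cannot cancel them, so the support still spans.
  let x : ι →₀ ℝ := ∑ k, Finsupp.single (a k) (B.equivFun u k)
  have hx0 : ∀ i, 0 ≤ x i := fun i => by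
    simp only [x, Finsupp.finsetSum_apply]
    refine Finset.sum_nonneg fun k _ => ?_
    rw [Finsupp.single_apply]
    split_ifs
    · exact (hu k).le
    · exact le_rfl
  have hxa : ∀ k, 0 < x (a k) := fun k => by
    have : x (a k) = B.equivFun u k := by
      simp only [x, Finsupp.finsetSum_apply, Finsupp.single_apply, hainj.eq_iff]
      simp
    rw [this]; exact hu k
  have hxu : Finsupp.linearCombination ℝ e x = u := by
    simp only [x, map_sum, Finsupp.linearCombination_single, ← hB]
    exact B.sum_equivFun u
  refine ⟨x + y, fun i => add_nonneg (hx0 i) (hy i), by rw [map_add, hxu], ?_⟩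
  rw [eq_top_iff, ← hspan, ← haspan]
  refine Submodule.span_mono ?_
  rintro _ ⟨k, rfl⟩
  refine ⟨a k, ?_, rfl⟩
  rw [Finset.mem_coe, Finsupp.mem_support_iff]
  exact (add_pos_of_pos_of_nonneg (hxa k) (hy _)).ne'

theorem integrableOn_pow_mul_exp_neg (k : ℕ) :
    IntegrableOn (fun y : ℝ => y ^ k * Real.exp (-y)) (Set.Ioi 0) := by
  have := Real.GammaIntegral_convergent (s := k + 1) (by positivity)
  refine this.congr_fun (fun y hy => ?_) measurableSet_Ioi
  simp [mul_comm]

theorem integral_pow_mul_exp_neg (k : ℕ) :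
    ∫ y in Set.Ioi (0 : ℝ), y ^ k * Real.exp (-y) = k.factorial := by
  rw [← Real.Gamma_nat_eq_factorial, Real.Gamma_eq_integral (by positivity)]
  refine setIntegral_congr_fun measurableSet_Ioi fun y hy => ?_
  simp [mul_comm]

/-- The evaluation of the monomials of degree at most `m` at a point of `ℝⁿ`. They are indexed by
the exponents of the monomials of degree `m` in `n + 1` homogeneous coordinates. -/
def momentVector {n : ℕ} (m : ℕ) (t : Fin n → ℝ)
    (b : Finset.piAntidiag (Finset.univ : Finset (Fin (n + 1))) m) : ℝ :=
  ∏ j, t j ^ b.1 (Fin.succ j)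

/-- Dehomogenization by `t = y / y₀`; it transfers the sign of a polynomial to its homogenization.
-/
theorem prod_pow_eq_pow_mul_momentVector {n m : ℕ} {y : Fin (n + 1) → ℝ} (hy : 0 < y 0)
    (b : Finset.piAntidiag (Finset.univ : Finset (Fin (n + 1))) m) :
    ∏ i, y i ^ b.1 i = y 0 ^ m * momentVector m (fun j : Fin n => y j.succ / y 0) b := by
  have hb := (Finset.mem_piAntidiag.1 b.2).1
  rw [Fin.sum_univ_succ] at hb
  rw [Fin.prod_univ_succ]
  have h0 : y 0 ^ m = y 0 ^ b.1 0 * y 0 ^ ∑ j : Fin n, b.1 j.succ := by rw [← pow_add, hb]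
  rw [h0, mul_assoc]
  congr 1
  rw [momentVector, ← Finset.prod_pow_eq_pow_sum, ← Finset.prod_mul_distrib]
  refine Finset.prod_congr rfl fun j _ => ?_
  rw [← mul_pow, mul_div_cancel₀ _ hy.ne']

/-- A polynomial of degree at most `m` that is non-positive on the positive orthant has a negative
integral against the moments of the Fubini–Study measure, or vanishes. -/
theorem eq_zero_of_momentVector_nonpos {n m : ℕ}
    (q : Finset.piAntidiag (Finset.univ : Finset (Fin (n + 1))) m → ℝ)
    (hq : ∀ t : Fin n → ℝ, (∀ j, 0 < t j) → ∑ b, q b * momentVector m t b ≤ 0)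
    (hc : 0 ≤ ∑ b, q b * ∏ i, ((b.1 i).factorial : ℝ)) : q = 0 := by
  -- The integral over `P` of the homogenization `Q` against `exp(-∑ yᵢ)` is `∑ q_b ∏ bᵢ!`, by the
  -- Gamma integrals. As `Q ≤ 0` on `P`, a non-negative value forces `Q = 0` there.
  let P : Set (Fin (n + 1) → ℝ) := Set.univ.pi fun _ => Set.Ioi 0
  let Q : (Fin (n + 1) → ℝ) → ℝ := fun y => ∑ b, q b * ∏ i, y i ^ b.1 i
  let G : (Fin (n + 1) → ℝ) → ℝ := fun y => ∑ b, q b * ∏ i, (y i ^ b.1 i * Real.exp (-y i))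
  have hGQ : ∀ y, G y = Q y * ∏ i, Real.exp (-y i) := fun y => by
    simp only [G, Q, Finset.prod_mul_distrib, Finset.sum_mul, mul_assoc]
  have hPo : IsOpen P := isOpen_set_pi Set.finite_univ fun _ _ => isOpen_Ioi
  have hQP : ∀ y ∈ P, Q y ≤ 0 := by
    intro y hy
    have hy' : ∀ i, 0 < y i := fun i => hy i trivial
    have : Q y = y 0 ^ m * ∑ b, q b * momentVector m (fun j : Fin n => y j.succ / y 0) b := by
      simp only [Q, prod_pow_eq_pow_mul_momentVector (hy' 0), Finset.mul_sum]
      exact Finset.sum_congr rfl fun b _ => by ring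
    rw [this]
    exact mul_nonpos_of_nonneg_of_nonpos (pow_nonneg (hy' 0).le _)
      (hq _ fun j => div_pos (hy' _) (hy' 0))
  have hvol : (volume : Measure (Fin (n + 1) → ℝ)).restrict P =
      Measure.pi fun _ => volume.restrict (Set.Ioi 0) := by
    rw [volume_pi, Measure.restrict_pi_pi]
  have hint : ∀ b : Finset.piAntidiag (Finset.univ : Finset (Fin (n + 1))) m,
      IntegrableOn (fun y : Fin (n + 1) → ℝ => ∏ i, (y i ^ b.1 i * Real.exp (-y i))) P := by
    intro b
    rw [IntegrableOn, hvol]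
    exact Integrable.fintype_prod (f := fun i (s : ℝ) => s ^ b.1 i * Real.exp (-s))
      fun i => integrableOn_pow_mul_exp_neg _
  have hGint : IntegrableOn G P := integrable_finsetSum _ fun b _ => (hint b).const_mul _
  have hGval : ∫ y in P, G y = ∑ b, q b * ∏ i, ((b.1 i).factorial : ℝ) := by
    rw [integral_finsetSum _ fun b _ => (hint b).const_mul _]
    refine Finset.sum_congr rfl fun b _ => ?_
    rw [integral_const_mul, hvol,
      integral_fintype_prod_eq_prod (fun i (s : ℝ) => s ^ b.1 i * Real.exp (-s))]
    simp only [integral_pow_mul_exp_neg]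
  have hG0 : ∀ y ∈ P, G y ≤ 0 := fun y hy => by
    rw [hGQ]
    exact mul_nonpos_of_nonpos_of_nonneg (hQP y hy)
      (Finset.prod_nonneg fun _ _ => (Real.exp_pos _).le)
  have hG1 : ∫ y in P, -G y = 0 := by
    refine le_antisymm ?_ (setIntegral_nonneg hPo.measurableSet fun y hy => neg_nonneg.2 (hG0 y hy))
    rw [integral_neg, hGval]
    linarith
  have hGae : (fun y => -G y) =ᵐ[volume.restrict P] 0 :=
    (integral_eq_zero_iff_of_nonneg_ae ((ae_restrict_iff' hPo.measurableSet).2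
      (Filter.Eventually.of_forall fun y hy => neg_nonneg.2 (hG0 y hy))) hGint.neg).1 hG1
  have hGc : Continuous G := by
    refine continuous_finsetSum _ fun b _ => ?_
    fun_prop
  have hGeq : Set.EqOn (fun y => -G y) 0 P :=
    Measure.eqOn_open_of_ae_eq hGae hPo hGc.neg.continuousOn continuousOn_const
  have hQeq : ∀ y ∈ P, Q y = 0 := fun y hy => by
    have := hGeq hy
    simp only [Pi.zero_apply, neg_eq_zero, hGQ] at this
    exact (mul_eq_zero.1 this).resolve_right
      (Finset.prod_pos fun _ _ => Real.exp_pos _).ne'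
  -- A polynomial that vanishes on a product of infinite sets is zero, so the coefficients `q`
  -- vanish.
  let p : MvPolynomial (Fin (n + 1)) ℝ :=
    ∑ b : Finset.piAntidiag (Finset.univ : Finset (Fin (n + 1))) m,
      MvPolynomial.monomial (Finsupp.equivFunOnFinite.symm b.1) (q b)
  have hp : p = 0 := by
    refine MvPolynomial.funext_set (fun _ => Set.Ioi 0) (fun _ => Set.Ioi_infinite 0) fun y hy => ?_
    rw [map_zero, ← hQeq y hy]
    simp only [p, Q, map_sum, MvPolynomial.eval_monomial]
    refine Finset.sum_congr rfl fun b _ => ?_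
    rw [Finsupp.prod_fintype _ _ fun _ => pow_zero _]
    rfl
  funext b
  have := congrArg (MvPolynomial.coeff (Finsupp.equivFunOnFinite.symm b.1)) hp
  rw [MvPolynomial.coeff_zero, MvPolynomial.coeff_sum, Finset.sum_eq_single b] at this
  · simpa using this
  · intro b' _ hb'
    rw [MvPolynomial.coeff_monomial, if_neg]
    intro heq
    exact hb' (Subtype.ext (Finsupp.equivFunOnFinite.symm.injective heq))
  · simp

/-- Cubature with positive weights for the moments of the Fubini–Study measure. -/
theorem exists_cubature (n m : ℕ) :
    ∃ (S : Finset (Fin n → ℝ)) (w : (Fin n → ℝ) → ℝ), (∀ p ∈ S, ∀ j, 0 < p j) ∧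
      (∀ p ∈ S, 0 < w p) ∧
      (∀ b : Finset.piAntidiag (Finset.univ : Finset (Fin (n + 1))) m,
        ∑ p ∈ S, w p * momentVector m p b = ∏ i, ((b.1 i).factorial : ℝ)) ∧
      Submodule.span ℝ (momentVector m '' (S : Set (Fin n → ℝ))) = ⊤ := by
  classical
  -- A functional on the moment space is a polynomial of degree at most `m`; the separation
  -- hypothesis is then exactly `eq_zero_of_momentVector_nonpos`.
  obtain ⟨x, hx0, hx, hspan⟩ := exists_finsupp_linearCombination_eq
    (ι := {t : Fin n → ℝ // ∀ j, 0 < t j}) (fun t => momentVector m t.1)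
    (fun b => ∏ i, ((b.1 i).factorial : ℝ)) (fun f hf hfc => by
      have hsum : ∀ v, f v = ∑ b, f (Pi.single b 1) * v b := fun v => by
        have hv : v = ∑ b, v b • (Pi.single b (1 : ℝ)) := by
          ext b; simp [Finset.sum_apply, Pi.single_apply]
        nth_rw 1 [hv]
        simp [mul_comm]
      have := eq_zero_of_momentVector_nonpos (fun b => f (Pi.single b 1))
        (fun t ht => by rw [← hsum]; exact hf ⟨t, ht⟩) (by rw [← hsum]; exact hfc)
      ext v
      rw [hsum v]
      simp only [funext_iff, Pi.zero_apply] at this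
      simp [this])
  refine ⟨x.support.map (Function.Embedding.subtype _),
    fun t => if ht : ∀ j, 0 < t j then x ⟨t, ht⟩ else 0, ?_, ?_, ?_, ?_⟩
  · simp only [Finset.mem_map, Function.Embedding.coe_subtype]
    rintro _ ⟨p, -, rfl⟩
    exact p.2
  · simp only [Finset.mem_map, Function.Embedding.coe_subtype]
    rintro _ ⟨p, hp, rfl⟩
    rw [dif_pos p.2]
    exact (hx0 p).lt_of_ne' (Finsupp.mem_support_iff.1 hp)
  · intro b
    rw [← congrFun hx b, Finset.sum_map, Finsupp.linearCombination_apply, Finsupp.sum,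
      Finset.sum_apply]
    refine Finset.sum_congr rfl fun p _ => ?_
    have := p.2
    simp [this]
  · rw [eq_top_iff, ← hspan]
    refine Submodule.span_mono ?_
    rintro _ ⟨p, hp, rfl⟩
    exact ⟨p.1, by simpa [p.2] using hp, rfl⟩

/-! ### Prescribing moments by the volumes of small balls -/

theorem continuousOn_of_abs_sub_le {V φ : ℝ → ℝ} {s : Set ℝ} (hφ : ContinuousOn φ s)
    (h : ∀ x ∈ s, ∀ y ∈ s, |V x - V y| ≤ |φ x - φ y|) : ContinuousOn V s := by
  intro y hy
  refine tendsto_iff_norm_sub_tendsto_zero.2 ?_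
  refine squeeze_zero' (Filter.Eventually.of_forall fun x => norm_nonneg _)
    (eventually_nhdsWithin_of_forall fun x hx => h x hx y hy)
    (tendsto_iff_norm_sub_tendsto_zero.1 (hφ y hy))

section Bodies

variable {X V : Type*} [PseudoMetricSpace X] [MeasurableSpace X] [OpensMeasurableSpace X]
  [NormedAddCommGroup V] [NormedSpace ℝ V] {ν : Measure X} {B : Set X} {φ : ℝ → ℝ} {R : ℝ} {p : X}

/-- The balls about a point exhaust continuously the volume outside of a given small set. -/
theorem exists_ball_diff_measureReal_eq (hB : MeasurableSet B) (hR : 0 ≤ R)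
    (hφc : Continuous φ) (hφn : ∀ r, 0 ≤ r → 0 ≤ φ r)
    (hφ : ∀ r, 0 ≤ r → r ≤ R → ν (Metric.ball p r) = ENNReal.ofReal (φ r))
    (hBν : ν B ≤ ENNReal.ofReal (φ R / 2)) {x : ℝ} (hx : 0 ≤ x) (hxR : x ≤ φ R / 2) :
    ∃ r, 0 ≤ r ∧ r ≤ R ∧ ν.real (Metric.ball p r \ B) = x := by
  have hreal : ∀ r, 0 ≤ r → r ≤ R → ν.real (Metric.ball p r) = φ r := fun r h0 h1 => by
    rw [Measure.real, hφ r h0 h1, ENNReal.toReal_ofReal (hφn r h0)]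
  have hfin : ∀ r, 0 ≤ r → r ≤ R → ν (Metric.ball p r) ≠ ⊤ := fun r h0 h1 => by
    rw [hφ r h0 h1]; exact ENNReal.ofReal_ne_top
  -- Removing `B` can only decrease the volume of a shell, so continuity in the radius is inherited
  -- from `φ`. The intermediate value theorem then applies between radius `0` and radius `R`, where
  -- at least half of the ball is left.
  have hmono : ∀ a b, 0 ≤ a → a ≤ b → b ≤ R →
      |ν.real (Metric.ball p b \ B) - ν.real (Metric.ball p a \ B)| ≤ |φ b - φ a| := by
    intro a b ha hab hb
    have hsub : Metric.ball p a \ B ⊆ Metric.ball p b \ B :=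
      Set.sdiff_subset_sdiff_left (Metric.ball_subset_ball hab)
    have hm : ∀ r, MeasurableSet (Metric.ball p r \ B) := fun r =>
      Metric.isOpen_ball.measurableSet.diff hB
    have hf : ∀ r, 0 ≤ r → r ≤ R → ν (Metric.ball p r \ B) ≠ ⊤ := fun r h0 h1 =>
      measure_ne_top_of_subset Set.sdiff_subset (hfin r h0 h1)
    rw [← measureReal_sdiff hsub (hm a) (hf b (ha.trans hab) hb),
      abs_of_nonneg measureReal_nonneg, ← hreal b (ha.trans hab) hb, ← hreal a ha (hab.trans hb),
      ← measureReal_sdiff (Metric.ball_subset_ball hab) Metric.isOpen_ball.measurableSet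
        (hfin b (ha.trans hab) hb), abs_of_nonneg measureReal_nonneg]
    refine measureReal_mono ?_ (measure_ne_top_of_subset Set.sdiff_subset (hfin b (ha.trans hab) hb))
    rintro t ⟨⟨h1, h2⟩, h3⟩
    exact ⟨h1, fun h4 => h3 ⟨h4, h2⟩⟩
  have hcont : ContinuousOn (fun r => ν.real (Metric.ball p r \ B)) (Set.Icc 0 R) := by
    refine continuousOn_of_abs_sub_le hφc.continuousOn fun a ha b hb => ?_
    rcases le_total a b with hab | hab
    · rw [abs_sub_comm, abs_sub_comm (φ a)]
      exact hmono a b ha.1 hab hb.2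
    · exact hmono b a hb.1 hab ha.2
  have h0 : ν.real (Metric.ball p 0 \ B) = 0 := by simp
  have h1 : φ R / 2 ≤ ν.real (Metric.ball p R \ B) := by
    have h2 : ν.real (Metric.ball p R) ≤ ν.real (Metric.ball p R \ B) + ν.real B := by
      refine (measureReal_mono (s₂ := (Metric.ball p R \ B) ∪ B) (fun t ht => ?_)
        (ne_of_lt ?_)).trans (measureReal_union_le _ _)
      · by_cases h : t ∈ B
        · exact Or.inr h
        · exact Or.inl ⟨ht, h⟩
      · exact (measure_union_le _ _).trans_lt (ENNReal.add_lt_top.2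
          ⟨(measure_mono Set.sdiff_subset).trans_lt (hfin R hR le_rfl).lt_top,
            hBν.trans_lt ENNReal.ofReal_lt_top⟩)
    have h3 : ν.real B ≤ φ R / 2 := by
      have := hφn R hR
      exact ENNReal.toReal_le_of_le_ofReal (by linarith) hBν
    rw [hreal R hR le_rfl] at h2
    linarith
  obtain ⟨r, hr, hrx⟩ := intermediate_value_Icc hR hcont ⟨h0.symm ▸ hx, hxR.trans h1⟩
  exact ⟨r, hr.1, hr.2, hrx⟩

/-- The integral of a nearly constant function over growing bodies is nearly linear in their volume.
-/
theorem norm_setIntegral_diff_sub_le {X : Type*} [MeasurableSpace X] {ν : Measure X} {e : X → V} [CompleteSpace V] {s t : Set X}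
    (hs : MeasurableSet s) (hst : s ⊆ t) (htν : ν t ≠ ⊤)
    (he : IntegrableOn e t ν) {κ : ℝ} {v : V} (hκ : ∀ x ∈ t, ‖e x - v‖ ≤ κ) :
    ‖∫ x in t, e x ∂ν - ∫ x in s, e x ∂ν - (ν.real t - ν.real s) • v‖ ≤
      κ * (ν.real t - ν.real s) := by
  have hd : ν (t \ s) < ⊤ := (measure_mono Set.sdiff_subset).trans_lt htν.lt_top
  rw [← setIntegral_sdiff hs he hst, ← measureReal_sdiff hst hs htν]
  have h1 : ∫ x in t \ s, v ∂ν = ν.real (t \ s) • v := by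
    rw [setIntegral_const]
  rw [← h1, ← integral_sub (he.mono_set Set.sdiff_subset) (integrableOn_const hd.ne)]
  exact norm_setIntegral_le_of_norm_le_const hd fun x hx => hκ x hx.1

end Bodies

/-- Prescription of finitely many moments: if `c` is a positive combination of values of `e` that
span `V`, then each small multiple of `c` is the integral of `e` over the union of a given set `B`
of small volume with suitable small balls. -/
theorem exists_union_balls_setIntegral_eq {X V : Type*} [MetricSpace X] [MeasurableSpace X]
    [OpensMeasurableSpace X] [NormedAddCommGroup V] [NormedSpace ℝ V] [FiniteDimensional ℝ V]
    [SecondCountableTopologyEither X V] {ν : Measure X} {S : Finset X} {w : X → ℝ} {e : X → V}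
    {c : V} (he : Continuous e) (hw : ∀ p ∈ S, 0 < w p) (hc : ∑ p ∈ S, w p • e p = c)
    (hspan : Submodule.span ℝ (e '' S) = ⊤) {φ : ℝ → ℝ} (hφc : Continuous φ)
    (hφn : ∀ r, 0 ≤ r → 0 ≤ φ r) (hφp : ∀ r, 0 < r → 0 < φ r) {R₀ : ℝ} (hR₀ : 0 < R₀)
    (hφ : ∀ p ∈ S, ∀ r, 0 ≤ r → r ≤ R₀ → ν (Metric.ball p r) = ENNReal.ofReal (φ r)) :
    ∃ η, 0 < η ∧ ∃ ε₀, 0 < ε₀ ∧ ∀ ε, 0 < ε → ε < ε₀ → ∀ B, MeasurableSet B → IntegrableOn e B ν →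
      ν B ≤ ENNReal.ofReal (ε * η) → ‖∫ x in B, e x ∂ν‖ ≤ ε * η →
      ∃ r : X → ℝ, (∀ p ∈ S, 0 < r p) ∧
        IntegrableOn e (B ∪ ⋃ p ∈ S, Metric.ball p (r p)) ν ∧
        ∫ x in B ∪ ⋃ p ∈ S, Metric.ball p (r p), e x ∂ν = ε • c := by
  classical
  have : CompleteSpace V := FiniteDimensional.complete ℝ V
  let A : (S → ℝ) →L[ℝ] V :=
    LinearMap.toContinuousLinearMap (Fintype.linearCombination ℝ fun p : S => e p)
  have hA : ∀ x, A x = ∑ p : S, x p • e p := fun x =>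
    Fintype.linearCombination_apply ℝ (fun p : S => e p) x
  have hAsurj : A.range = ⊤ := by
    rw [eq_top_iff, ← hspan, Submodule.span_le]
    rintro _ ⟨p, hp, rfl⟩
    exact ⟨Pi.single ⟨p, hp⟩ 1, by simp [hA, Pi.single_apply]⟩
  let N := A.nonlinearRightInverseOfSurjective hAsurj
  have hN : 0 < (N.nnnorm : ℝ) := A.nonlinearRightInverseOfSurjective_nnnorm_pos hAsurj
  -- With `ω` below all weights, the ball of radius `ε * ω` about `ε • w` consists of positive
  -- volume vectors.
  obtain ⟨ω, hω, hωw⟩ : ∃ ω, 0 < ω ∧ ∀ p ∈ S, ω < w p := by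
    rcases S.eq_empty_or_nonempty with rfl | hne
    · exact ⟨1, one_pos, by simp⟩
    · obtain ⟨p, hp, hmin⟩ := S.exists_min_image w hne
      exact ⟨w p / 2, half_pos (hw p hp), fun q hq => by linarith [hmin q hq, hw p hp]⟩
  obtain ⟨W, hW, hwW⟩ : ∃ W, 0 < W ∧ ∀ p ∈ S, w p ≤ W := by
    refine ⟨∑ p ∈ S, w p + 1, ?_, fun p hp => ?_⟩
    · linarith [Finset.sum_nonneg fun p hp => (hw p hp).le]
    · linarith [Finset.single_le_sum (fun p hp => (hw p hp).le) hp]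
  let s : ℝ := S.card
  have hs0 : 0 ≤ s := Nat.cast_nonneg _
  -- The oscillation of `e` allowed on the balls. The error `s * κ` of the linearization, multiplied
  -- by `W + ω`, uses at most half of the budget `N.nnnorm⁻¹ * ω`; the other half is `η`, left for
  -- the contribution of `B`.
  let κ : ℝ := (N.nnnorm : ℝ)⁻¹ * ω / (2 * (s + 1) * (W + ω))
  have hκ : 0 < κ := by positivity
  have hκs : s * κ * (W + ω) ≤ (N.nnnorm : ℝ)⁻¹ * ω / 2 := by
    have : s * κ * (W + ω) = (N.nnnorm : ℝ)⁻¹ * ω / 2 * (s / (s + 1)) := by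
      simp only [κ]; field_simp
    rw [this]
    exact mul_le_of_le_one_right (by positivity) (by rw [div_le_one (by positivity)]; linarith)
  obtain ⟨R, hR, hRR₀, hRe, hRd⟩ : ∃ R, 0 < R ∧ R ≤ R₀ ∧
      (∀ p ∈ S, ∀ x ∈ Metric.ball p R, ‖e x - e p‖ ≤ κ) ∧
      (∀ p ∈ S, ∀ q ∈ S, p ≠ q → Disjoint (Metric.ball p R) (Metric.ball q R)) := by
    have h1 : ∀ᶠ R : ℝ in nhdsWithin 0 (Set.Ioi 0), ∀ p ∈ S, ∀ x ∈ Metric.ball p R,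
        ‖e x - e p‖ ≤ κ := by
      refine (Filter.eventually_all_finset S).2 fun p _ => ?_
      obtain ⟨δ, hδ, h⟩ := Metric.continuous_iff.1 he p κ hκ
      filter_upwards [Ioo_mem_nhdsGT hδ] with R hR x hx
      rw [← dist_eq_norm]
      exact (h x ((Metric.mem_ball.1 hx).trans hR.2)).le
    have h2 : ∀ᶠ R : ℝ in nhdsWithin 0 (Set.Ioi 0), ∀ p ∈ S, ∀ q ∈ S, p ≠ q →
        Disjoint (Metric.ball p R) (Metric.ball q R) := by
      refine (Filter.eventually_all_finset S).2 fun p _ =>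
        (Filter.eventually_all_finset S).2 fun q _ => ?_
      by_cases hpq : p = q
      · exact Filter.Eventually.of_forall fun _ h => absurd hpq h
      · filter_upwards [Ioo_mem_nhdsGT (half_pos (dist_pos.2 hpq))] with R hR _
        exact Metric.ball_disjoint_ball (by linarith [hR.2])
    obtain ⟨R, h⟩ := (h1.and (h2.and (Ioc_mem_nhdsGT hR₀))).exists
    exact ⟨R, h.2.2.1, h.2.2.2, h.1, h.2.1⟩
  let v₀ := φ R / 2
  have hv₀ : 0 < v₀ := half_pos (hφp R hR)
  let η := (N.nnnorm : ℝ)⁻¹ * ω / 2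
  have hη : 0 < η := by positivity
  -- The first bound makes `B` occupy at most half the volume of a ball of radius `R`; the second
  -- keeps all relevant volumes `ε * (w p ± ω)` below `v₀`.
  refine ⟨η, hη, min (v₀ / η) (v₀ / (W + ω)), by positivity, fun ε hε hεε₀ B hB heB hBν hBe => ?_⟩
  have hε1 : ε * η ≤ v₀ := ((lt_div_iff₀ hη).1 (hεε₀.trans_le (min_le_left _ _))).le
  have hε2 : ε * (W + ω) ≤ v₀ :=
    ((lt_div_iff₀ (by positivity)).1 (hεε₀.trans_le (min_le_right _ _))).le
  -- `ρ p x` is a radius for which the ball about `p` has volume `x` outside `B`; the value `0` is a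
  -- default for irrelevant arguments.
  have hbody : ∀ (p : X) (x : ℝ), ∃ r, p ∈ S → 0 ≤ x → x ≤ v₀ →
      0 ≤ r ∧ r ≤ R ∧ ν.real (Metric.ball p r \ B) = x := by
    intro p x
    by_cases h : p ∈ S ∧ 0 ≤ x ∧ x ≤ v₀
    · obtain ⟨r, hr⟩ := exists_ball_diff_measureReal_eq hB hR.le hφc hφn
        (fun r h0 h1 => hφ p h.1 r h0 (h1.trans hRR₀))
        (hBν.trans (ENNReal.ofReal_le_ofReal hε1)) h.2.1 h.2.2
      exact ⟨r, fun _ _ _ => hr⟩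
    · exact ⟨0, fun h1 h2 h3 => absurd ⟨h1, h2, h3⟩ h⟩
  choose ρ hρ using hbody
  let b : X → ℝ → Set X := fun p x => Metric.ball p (ρ p x) \ B
  let g : X → ℝ → V := fun p x => ∫ t in b p x, e t ∂ν
  have hbm : ∀ p x, MeasurableSet (b p x) := fun p x => Metric.isOpen_ball.measurableSet.diff hB
  have hbsub : ∀ p ∈ S, ∀ x, 0 ≤ x → x ≤ v₀ → b p x ⊆ Metric.ball p R := fun p hp x h0 h1 =>
    Set.sdiff_subset.trans (Metric.ball_subset_ball (hρ p x hp h0 h1).2.1)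
  have hbfin : ∀ p ∈ S, ∀ x, 0 ≤ x → x ≤ v₀ → ν (b p x) ≠ ⊤ := fun p hp x h0 h1 =>
    measure_ne_top_of_subset (hbsub p hp x h0 h1)
      (by rw [hφ p hp R hR.le hRR₀]; exact ENNReal.ofReal_ne_top)
  have hbint : ∀ p ∈ S, ∀ x, 0 ≤ x → x ≤ v₀ → IntegrableOn e (b p x) ν := by
    intro p hp x h0 h1
    refine Measure.integrableOn_of_bounded (M := ‖e p‖ + κ) (hbfin p hp x h0 h1)
      he.aestronglyMeasurable ((ae_restrict_iff' (hbm p x)).2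
        (Filter.Eventually.of_forall fun t ht => ?_))
    have h2 := hRe p hp t (hbsub p hp x h0 h1 ht)
    have h3 := norm_le_norm_add_norm_sub' (e t) (e p)
    linarith
  have hgmono : ∀ p ∈ S, ∀ x y, 0 ≤ x → x ≤ y → y ≤ v₀ →
      ‖g p y - g p x - (y - x) • e p‖ ≤ κ * (y - x) := by
    intro p hp x y h0 hxy h1
    have hx := hρ p x hp h0 (hxy.trans h1)
    have hy := hρ p y hp (h0.trans hxy) h1
    have hsub : b p x ⊆ b p y := by
      -- The radii were chosen without any monotonicity, but a strictly larger volume forces a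
      -- radius at least as large.
      rcases hxy.eq_or_lt with rfl | hlt
      · exact subset_rfl
      · refine Set.sdiff_subset_sdiff_left (Metric.ball_subset_ball (le_of_not_gt fun h => ?_))
        have : ν.real (b p y) ≤ ν.real (b p x) :=
          measureReal_mono (Set.sdiff_subset_sdiff_left (Metric.ball_subset_ball h.le))
            (hbfin p hp x h0 (hxy.trans h1))
        have e1 : ν.real (b p y) = y := hy.2.2
        have e2 : ν.real (b p x) = x := hx.2.2
        linarith
    have := norm_setIntegral_diff_sub_le (hbm p x) hsub
      (hbfin p hp y (h0.trans hxy) h1) (hbint p hp y (h0.trans hxy) h1)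
      (fun t ht => hRe p hp t (hbsub p hp y (h0.trans hxy) h1 ht))
    have e1 : ν.real (b p y) = y := hy.2.2
    have e2 : ν.real (b p x) = x := hx.2.2
    rwa [e1, e2] at this
  have hglip : ∀ p ∈ S, ∀ x y, 0 ≤ x → x ≤ v₀ → 0 ≤ y → y ≤ v₀ →
      ‖g p x - g p y - (x - y) • e p‖ ≤ κ * |x - y| := by
    intro p hp x y hx0 hx1 hy0 hy1
    rcases le_total x y with h | h
    · have := hgmono p hp x y hx0 h hy1
      have e1 : g p x - g p y - (x - y) • e p = -(g p y - g p x - (y - x) • e p) := by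
        rw [← neg_sub y x, neg_smul]
        abel
      rwa [abs_sub_comm, abs_of_nonneg (sub_nonneg.2 h), e1, norm_neg]
    · rw [abs_of_nonneg (sub_nonneg.2 h)]
      exact hgmono p hp y x hy0 h hx1
  -- `F` sends the volumes to the total integral over the balls outside `B`. It differs from the
  -- surjective linear map `A` by a map of Lipschitz constant `s * κ`, so it covers a ball about `F
  -- x₀`.
  let F : (S → ℝ) → V := fun x => ∑ p : S, g p (x p)
  let D : Set (S → ℝ) := Set.Icc 0 fun _ => v₀
  have hFA : ∀ x ∈ D, ∀ y ∈ D, ‖F x - F y - A (x - y)‖ ≤ s * κ * ‖x - y‖ := by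
    intro x hx y hy
    have : F x - F y - A (x - y) = ∑ p : S, (g p (x p) - g p (y p) - (x p - y p) • e p) := by
      simp only [F, hA, Finset.sum_sub_distrib, Pi.sub_apply]
    rw [this]
    calc _ ≤ ∑ p : S, κ * ‖x - y‖ := by
          refine norm_sum_le_of_le _ fun p _ =>
            (hglip p p.2 _ _ (hx.1 p) (hx.2 p) (hy.1 p) (hy.2 p)).trans ?_
          gcongr
          exact norm_le_pi_norm (x - y) p
      _ = s * κ * ‖x - y‖ := by simp [s, mul_assoc]
  have happ : ApproximatesLinearOn F A D ⟨s * κ, by positivity⟩ := hFA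
  let x₀ : S → ℝ := fun p => ε * w p
  have hball : ∀ x ∈ Metric.closedBall x₀ (ε * ω), x ∈ D ∧ ∀ p, 0 < x p := by
    intro x hx
    have hx' : ∀ p : S, |x p - ε * w p| ≤ ε * ω := fun p =>
      (norm_le_pi_norm (x - x₀) p).trans (mem_closedBall_iff_norm.1 hx)
    have hpos : ∀ p : S, 0 < x p := fun p => by
      have h1 := (abs_le.1 (hx' p)).1
      have h2 := mul_lt_mul_of_pos_left (hωw p p.2) hε
      linarith
    refine ⟨⟨fun p => (hpos p).le, fun p => ?_⟩, hpos⟩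
    have h1 := (abs_le.1 (hx' p)).2
    have h2 := mul_le_mul_of_nonneg_left (hwW p p.2) hε.le
    simp only
    linarith
  have hsurj := happ.surjOn_closedBall_of_nonlinearRightInverse N (b := x₀) (ε := ε * ω)
    (by positivity) fun x hx => (hball x hx).1
  have hAx₀ : A x₀ = ε • c := by
    rw [hA, ← hc, Finset.smul_sum, ← Finset.sum_coe_sort S]
    exact Finset.sum_congr rfl fun p _ => by simp only [x₀, smul_smul]
  have hF0 : F 0 = 0 := by
    refine Finset.sum_eq_zero fun p _ => ?_
    have h0 : ν.real (b p 0) = 0 := (hρ p 0 p.2 le_rfl hv₀.le).2.2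
    have : ν (b p 0) = 0 :=
      (measureReal_eq_zero_iff (hbfin p p.2 0 le_rfl hv₀.le)).1 h0
    exact setIntegral_measure_zero e this
  have h0D : (0 : S → ℝ) ∈ D := ⟨le_rfl, fun _ => hv₀.le⟩
  have hx₀n : ‖x₀‖ ≤ ε * W := by
    refine (pi_norm_le_iff_of_nonneg (by positivity)).2 fun p => ?_
    rw [Real.norm_of_nonneg (mul_nonneg hε.le (hw p p.2).le)]
    exact mul_le_mul_of_nonneg_left (hwW p p.2) hε.le
  have hFx₀ : ‖F x₀ - ε • c‖ ≤ s * κ * (ε * W) := by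
    have := hFA x₀ (hball x₀ (Metric.mem_closedBall_self (by positivity))).1 0 h0D
    rw [hF0, sub_zero, sub_zero, hAx₀] at this
    exact this.trans (by gcongr)
  -- The target lies within `s * κ * ε * W + ε * η` of `F x₀`, which fits in the covered radius
  -- `(N.nnnorm⁻¹ - s * κ) * ε * ω` by the choice of `κ` and `η`.
  obtain ⟨x, hx, hFx⟩ := hsurj (show ε • c - ∫ t in B, e t ∂ν ∈ _ by
    rw [mem_closedBall_iff_norm]
    have h1 : ‖ε • c - ∫ t in B, e t ∂ν - F x₀‖ ≤ ‖F x₀ - ε • c‖ + ‖∫ t in B, e t ∂ν‖ := by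
      rw [← norm_neg]
      refine (norm_add_le _ _).trans_eq' ?_
      congr 1
      abel
    have h2 := mul_le_mul_of_nonneg_left hκs hε.le
    have h3 : ((N.nnnorm : ℝ)⁻¹ - s * κ) * (ε * ω) =
        ε * ((N.nnnorm : ℝ)⁻¹ * ω) - s * κ * ω * ε := by ring
    have h4 : ε * η = ε * ((N.nnnorm : ℝ)⁻¹ * ω / 2) := rfl
    change _ ≤ ((N.nnnorm : ℝ)⁻¹ - s * κ) * (ε * ω)
    rw [h3]
    nlinarith)
  obtain ⟨hxD, hxpos⟩ := hball x hx
  let r : X → ℝ := fun p => if hp : p ∈ S then ρ p (x ⟨p, hp⟩) else 0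
  have hr : ∀ p : S, r p = ρ p (x p) := fun p => by simp [r]
  have hrb : ∀ p : S, Metric.ball p.1 (r p) \ B = b p (x p) := fun p => by rw [hr]
  have hunion : B ∪ ⋃ p ∈ S, Metric.ball p (r p) = B ∪ ⋃ p : S, b p (x p) := by
    ext t
    simp only [Set.mem_union, Set.mem_iUnion, ← hrb, Set.mem_sdiff]
    constructor
    · rintro (h | ⟨p, hp, h⟩)
      · exact Or.inl h
      · by_cases hB : t ∈ B
        · exact Or.inl hB
        · exact Or.inr ⟨⟨p, hp⟩, h, hB⟩
    · rintro (h | ⟨p, h, -⟩)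
      · exact Or.inl h
      · exact Or.inr ⟨p, p.2, h⟩
  have hint : ∀ p : S, IntegrableOn e (b p (x p)) ν := fun p =>
    hbint p p.2 _ (hxD.1 p) (hxD.2 p)
  have hintU : IntegrableOn e (⋃ p : S, b p (x p)) ν := integrableOn_finite_iUnion.2 hint
  refine ⟨r, fun p hp => ?_, ?_, ?_⟩
  · have h1 := hρ p _ hp (hxD.1 ⟨p, hp⟩) (hxD.2 ⟨p, hp⟩)
    rw [hr ⟨p, hp⟩]
    refine h1.1.lt_of_ne' fun h0 => ?_
    rw [h0, Metric.ball_zero] at h1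
    have := hxpos ⟨p, hp⟩
    have h2 := h1.2.2
    simp at h2
    linarith
  · rw [hunion]
    exact heB.union hintU
  · rw [hunion, setIntegral_union ?_ (MeasurableSet.iUnion fun p => hbm _ _) heB hintU,
      integral_iUnion_fintype (fun p => hbm _ _) ?_ hint]
    · change ∫ t in B, e t ∂ν + F x = ε • c
      rw [hFx]
      abel
    · intro p q hpq
      exact (hRd p p.2 q q.2 fun h => hpq (Subtype.ext h)).mono
        (hbsub p p.2 _ (hxD.1 p) (hxD.2 p)) (hbsub q q.2 _ (hxD.1 q) (hxD.2 q))
    · refine Set.disjoint_iUnion_right.2 fun p => ?_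
      exact Set.disjoint_sdiff_right

/-! ### Lebesgue measure in the squared moduli -/

/-- The image of the Lebesgue measure of `ℂ` under `w ↦ ‖w‖²`. -/
noncomputable def normSqMeasure : Measure ℝ := Measure.map (fun w : ℂ => ‖w‖ ^ 2) volume

/-- The area of an annulus is `π` times the difference of the squared radii. Hence in squared moduli
the volume does not depend on the center. -/
theorem normSqMeasure_Ioo {a r : ℝ} (hr : 0 ≤ r) (hra : r ≤ a) :
    normSqMeasure (Set.Ioo (a - r) (a + r)) = ENNReal.ofReal (2 * Real.pi * r) := by
  have h1 : 0 ≤ a - r := by linarith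
  have h2 : 0 ≤ a + r := by linarith
  have hpre : (fun w : ℂ => ‖w‖ ^ 2) ⁻¹' Set.Ioo (a - r) (a + r) =
      Metric.ball 0 √(a + r) \ Metric.closedBall 0 √(a - r) := by
    ext w
    rw [Set.mem_preimage, Set.mem_Ioo, Set.mem_sdiff, mem_ball_zero_iff, mem_closedBall_zero_iff,
      not_le, Real.sqrt_lt h1 (norm_nonneg _), Real.lt_sqrt (norm_nonneg _), and_comm]
  have hv : ∀ s : ℝ, 0 ≤ s → ENNReal.ofReal (√s) ^ 2 * (NNReal.pi : ENNReal) =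
      ENNReal.ofReal (s * Real.pi) := fun s hs => by
    have hpi : (NNReal.pi : ENNReal) = ENNReal.ofReal Real.pi := by
      rw [← NNReal.coe_real_pi, ENNReal.ofReal_coe_nnreal]
    rw [← ENNReal.ofReal_pow (Real.sqrt_nonneg _), Real.sq_sqrt hs, hpi, ENNReal.ofReal_mul hs]
  rw [normSqMeasure, Measure.map_apply (by fun_prop) measurableSet_Ioo, hpre]
  rcases hr.eq_or_lt with rfl | hr
  · have : Metric.ball (0 : ℂ) √(a + 0) \ Metric.closedBall 0 √(a - 0) = ∅ := by
      rw [add_zero, sub_zero, Set.sdiff_eq_empty]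
      exact Metric.ball_subset_closedBall
    rw [this]
    simp
  · rw [measure_sdiff _ Metric.isClosed_closedBall.measurableSet.nullMeasurableSet
      measure_closedBall_lt_top.ne, Complex.volume_ball, Complex.volume_closedBall, hv _ h1,
      hv _ h2, ← ENNReal.ofReal_sub _ (by positivity)]
    · congr 1
      ring
    · intro w hw
      rw [mem_closedBall_zero_iff] at hw
      rw [mem_ball_zero_iff]
      exact hw.trans_lt (Real.sqrt_lt_sqrt h1 (by linarith))

instance : NullSingletonClass normSqMeasure := by
  refine ⟨fun s => ?_⟩
  rw [normSqMeasure, Measure.map_apply (by fun_prop) (measurableSet_singleton s)]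
  refine measure_mono_null (fun w hw => ?_) (Measure.addHaar_sphere volume (0 : ℂ) √s)
  rw [mem_sphere_zero_iff_norm, ← show ‖w‖ ^ 2 = s from hw, Real.sqrt_sq (norm_nonneg _)]

instance : IsLocallyFiniteMeasure normSqMeasure := by
  refine ⟨fun s => ⟨Set.Iio (s + 1), Iio_mem_nhds (by linarith), ?_⟩⟩
  rw [normSqMeasure, Measure.map_apply (by fun_prop) measurableSet_Iio]
  refine (measure_mono fun w hw => ?_).trans_lt
    (measure_closedBall_lt_top (x := (0 : ℂ)) (r := √(s + 1)))
  rw [mem_closedBall_zero_iff]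
  exact Real.le_sqrt_of_sq_le (le_of_lt hw)

/-- The image of the Lebesgue measure of `ℂⁿ` under `z ↦ (‖z₁‖², …, ‖zₙ‖²)`. -/
noncomputable def radialMeasure (n : ℕ) : Measure (Fin n → ℝ) := Measure.pi fun _ => normSqMeasure

instance (n : ℕ) : IsLocallyFiniteMeasure (radialMeasure n) :=
  inferInstanceAs (IsLocallyFiniteMeasure (Measure.pi fun _ => normSqMeasure))

/-- The map `z ↦ (‖z₁‖², …, ‖zₙ‖²)`. -/
noncomputable def radialMap (n : ℕ) (z : Fin n → ℂ) : Fin n → ℝ := fun j => ‖z j‖ ^ 2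

theorem continuous_radialMap (n : ℕ) : Continuous (radialMap n) := by
  unfold radialMap
  fun_prop

theorem map_radialMap (n : ℕ) : Measure.map (radialMap n) volume = radialMeasure n := by
  have : SigmaFinite (Measure.map (fun w : ℂ => ‖w‖ ^ 2) volume) :=
    inferInstanceAs (SigmaFinite normSqMeasure)
  rw [volume_pi]
  exact Measure.pi_map_pi (f := fun (_ : Fin n) (w : ℂ) => ‖w‖ ^ 2) fun _ =>
    (by fun_prop : Measurable fun w : ℂ => ‖w‖ ^ 2).aemeasurable

theorem measurePreserving_radialMap (n : ℕ) :
    MeasurePreserving (radialMap n) volume (radialMeasure n) :=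
  ⟨(continuous_radialMap n).measurable, map_radialMap n⟩

/-- Sup-norm balls are cubes. For `r = 0` the ball is empty, which agrees with the right-hand side
only if `n ≠ 0`. -/
theorem radialMeasure_ball {n : ℕ} (hn : n ≠ 0) {p : Fin n → ℝ} {r : ℝ} (hr : 0 ≤ r)
    (hrp : ∀ j, r ≤ p j) :
    radialMeasure n (Metric.ball p r) = ENNReal.ofReal ((2 * Real.pi * r) ^ n) := by
  rcases hr.eq_or_lt with rfl | hr
  · simp [hn]
  · rw [ball_pi _ hr, radialMeasure, Measure.pi_pi]
    simp only [Real.ball_eq_Ioo]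
    rw [Finset.prod_congr rfl fun j _ => normSqMeasure_Ioo hr.le (hrp j), Finset.prod_const,
      Finset.card_univ, Fintype.card_fin, ENNReal.ofReal_pow (by positivity)]

/-- The radius is `v^(1/n) / (2π)`; the bound `1 / 2` keeps balls with centers `≥ 1` inside the
positive orthant and balls about successive integer points disjoint. -/
theorem exists_radialMeasure_ball_eq {n : ℕ} (hn : n ≠ 0) {v : ℝ} (hv : 0 < v) (hv1 : v ≤ 1) :
    ∃ r, 0 < r ∧ r ≤ 1 / 2 ∧ ∀ p : Fin n → ℝ, (∀ j, 1 ≤ p j) →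
      radialMeasure n (Metric.ball p r) = ENNReal.ofReal v := by
  have hpi := Real.pi_pos
  have hpi3 := Real.pi_gt_three
  have h0 : 0 < v ^ ((n : ℝ)⁻¹) := Real.rpow_pos_of_pos hv _
  have h1 : v ^ ((n : ℝ)⁻¹) ≤ 1 := Real.rpow_le_one hv.le hv1 (by positivity)
  have h2 : v ^ ((n : ℝ)⁻¹) / (2 * Real.pi) ≤ 1 / 2 := by
    rw [div_le_iff₀ (by positivity)]
    linarith
  refine ⟨v ^ ((n : ℝ)⁻¹) / (2 * Real.pi), by positivity, h2, fun p hp => ?_⟩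
  rw [radialMeasure_ball hn (by positivity) fun j => by linarith [hp j],
    mul_div_cancel₀ _ (by positivity), Real.rpow_inv_natCast_pow hv.le hn]

/-! ### Connected neighborhoods of combs -/

/-- `D` is a union of balls with centers in `s` and contains `s`. -/
def IsUnionOfBallsAt {X : Type*} [PseudoMetricSpace X] (s D : Set X) : Prop :=
  s ⊆ D ∧ ∀ x ∈ D, ∃ t ∈ s, ∃ r, x ∈ Metric.ball t r ∧ Metric.ball t r ⊆ D

namespace IsUnionOfBallsAt

variable {X : Type*} [PseudoMetricSpace X] {s D : Set X}

theorem isOpen (h : IsUnionOfBallsAt s D) : IsOpen D :=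
  isOpen_iff_mem_nhds.2 fun x hx => by
    obtain ⟨t, -, r, hxr, hr⟩ := h.2 x hx
    exact Filter.mem_of_superset (Metric.isOpen_ball.mem_nhds hxr) hr

theorem union_iUnion {ι : Sort*} (h : IsUnionOfBallsAt s D) (c : ι → X) (r : ι → ℝ)
    (hc : ∀ i, c i ∈ s) : IsUnionOfBallsAt s (D ∪ ⋃ i, Metric.ball (c i) (r i)) := by
  refine ⟨h.1.trans Set.subset_union_left, ?_⟩
  rintro x (hx | hx)
  · obtain ⟨t, ht, ρ, hxρ, hρ⟩ := h.2 x hx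
    exact ⟨t, ht, ρ, hxρ, hρ.trans Set.subset_union_left⟩
  · obtain ⟨i, hi⟩ := Set.mem_iUnion.1 hx
    exact ⟨c i, hc i, r i, hi, (Set.subset_iUnion (fun i => Metric.ball (c i) (r i)) i).trans
      Set.subset_union_right⟩

/-- An open neighborhood obtained from measure regularity may have components away from `s`; keeping
only the balls centered on `s` removes them. -/
theorem exists_subset {U : Set X} (hU : IsOpen U) (hs : s ⊆ U) :
    ∃ D ⊆ U, IsUnionOfBallsAt s D := by
  refine ⟨U ∩ {x | ∃ t ∈ s, ∃ r, x ∈ Metric.ball t r ∧ Metric.ball t r ⊆ U},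
    Set.inter_subset_left, fun t ht => ⟨hs ht, ?_⟩, ?_⟩
  · obtain ⟨r, hr, h⟩ := Metric.isOpen_iff.1 hU t (hs ht)
    exact ⟨t, ht, r, Metric.mem_ball_self hr, h⟩
  · rintro x ⟨-, t, ht, r, hxr, hr⟩
    exact ⟨t, ht, r, hxr, fun y hy => ⟨hr hy, t, ht, r, hy, hr⟩⟩

/-- Each ball meets `C` in a convex set which contains its center, a point of the preconnected set
`s`. -/
theorem isPreconnected_inter {E : Type*} [SeminormedAddCommGroup E] [NormedSpace ℝ E]
    {s D C : Set E} (h : IsUnionOfBallsAt s D) (hC : Convex ℝ C) (hsC : s ⊆ C)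
    (hs : IsPreconnected s) : IsPreconnected (D ∩ C) := by
  rcases s.eq_empty_or_nonempty with rfl | ⟨t₀, ht₀⟩
  · have : D = ∅ := Set.eq_empty_of_forall_notMem fun x hx => by
      obtain ⟨t, ht, -⟩ := h.2 x hx
      exact ht
    rw [this, Set.empty_inter]
    exact isPreconnected_empty
  · refine isPreconnected_of_forall t₀ fun y hy => ?_
    obtain ⟨t, ht, r, hyr, hr⟩ := h.2 y hy.1
    have htr : t ∈ Metric.ball t r := Metric.mem_ball_self (Metric.pos_of_mem_ball hyr)
    refine ⟨s ∪ (Metric.ball t r ∩ C), ?_, Or.inl ht₀, Or.inr ⟨hyr, hy.2⟩,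
      hs.union t ht ⟨htr, hsC ht⟩ ((convex_ball t r).inter hC).isPreconnected⟩
    exact Set.union_subset (Set.subset_inter h.1 hsC) (Set.inter_subset_inter_left _ hr)

end IsUnionOfBallsAt

/-- The intersection of the closed positive orthant with the union of the hyperplane `{tⱼ = 0}` and
of the hyperplanes `{tᵢ = a}` for `a ∈ Λ`. -/
def comb {n : ℕ} (i j : Fin n) (Λ : Set ℝ) : Set (Fin n → ℝ) :=
  {t | (∀ k, 0 ≤ t k) ∧ (t j = 0 ∨ t i ∈ Λ)}

/-- Each tooth `{tᵢ = a}` is convex in the orthant and meets the spine `{tⱼ = 0}` at `a` times the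
`i`-th unit vector. This needs two different indices, hence `n ≥ 2`. -/
theorem isPreconnected_comb {n : ℕ} {i j : Fin n} (hij : i ≠ j) {Λ : Set ℝ} :
    IsPreconnected (comb i j Λ) := by
  have hc : ∀ k a, Convex ℝ {t : Fin n → ℝ | (∀ l, 0 ≤ t l) ∧ t k = a} := by
    rintro k a t ⟨ht, hta⟩ u ⟨hu, hua⟩ b c hb hc hbc
    refine ⟨fun l => add_nonneg (mul_nonneg hb (ht l)) (mul_nonneg hc (hu l)), ?_⟩
    simp only [Pi.add_apply, Pi.smul_apply, smul_eq_mul]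
    rw [hta, hua, ← add_mul, hbc, one_mul]
  refine isPreconnected_of_forall 0 fun t ht => ?_
  rcases ht.2 with h | h
  · exact ⟨{t | (∀ l, 0 ≤ t l) ∧ t j = 0}, fun u hu => ⟨hu.1, Or.inl hu.2⟩,
      ⟨fun _ => le_rfl, rfl⟩, ⟨ht.1, h⟩, (hc j 0).isPreconnected⟩
  · refine ⟨{t | (∀ l, 0 ≤ t l) ∧ t j = 0} ∪ {u | (∀ l, 0 ≤ u l) ∧ u i = t i}, ?_,
      Or.inl ⟨fun _ => le_rfl, rfl⟩, Or.inr ⟨ht.1, rfl⟩,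
      (hc j 0).isPreconnected.union (Pi.single i (t i)) ?_ ?_ (hc i _).isPreconnected⟩
    · rintro u (hu | hu)
      · exact ⟨hu.1, Or.inl hu.2⟩
      · exact ⟨hu.1, Or.inr (hu.2 ▸ h)⟩
    · refine ⟨fun l => ?_, Pi.single_eq_of_ne hij.symm _⟩
      exact (Pi.single_nonneg.2 (ht.1 i) : (0 : Fin n → ℝ) ≤ _) l
    · refine ⟨fun l => ?_, Pi.single_eq_same _ _⟩
      exact (Pi.single_nonneg.2 (ht.1 i) : (0 : Fin n → ℝ) ≤ _) l

theorem radialMeasure_comb {n : ℕ} (i j : Fin n) {Λ : Set ℝ} (hΛ : Λ.Countable) :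
    radialMeasure n (comb i j Λ) = 0 := by
  refine measure_mono_null (t := Function.eval j ⁻¹' {0} ∪ Function.eval i ⁻¹' Λ)
    (fun t ht => ht.2) (measure_union_null ?_ ?_)
  · exact Measure.pi_eval_preimage_null _ (measure_singleton 0)
  · exact Measure.pi_eval_preimage_null _ (hΛ.measure_zero _)

/-! ### Moments of neighborhoods of combs -/

theorem norm_momentVector_le {n m : ℕ} (t : Fin n → ℝ) : ‖momentVector m t‖ ≤ (1 + ‖t‖) ^ m := by
  refine (pi_norm_le_iff_of_nonneg (by positivity)).2 fun b => ?_
  have hb := (Finset.mem_piAntidiag.1 b.2).1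
  rw [Fin.sum_univ_succ] at hb
  rw [momentVector, norm_prod]
  calc ∏ j, ‖t j ^ b.1 (Fin.succ j)‖ ≤ ∏ j, (1 + ‖t‖) ^ b.1 (Fin.succ j) := by
        refine Finset.prod_le_prod (fun _ _ => norm_nonneg _) fun j _ => ?_
        rw [norm_pow]
        gcongr
        linarith [norm_le_pi_norm t j]
    _ = (1 + ‖t‖) ^ ∑ j : Fin n, b.1 (Fin.succ j) := Finset.prod_pow_eq_pow_sum _ _ _
    _ ≤ (1 + ‖t‖) ^ m := by
        refine pow_le_pow_right₀ (by linarith [norm_nonneg t]) ?_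
        omega

theorem continuous_momentVector (n m : ℕ) :
    Continuous (momentVector m : (Fin n → ℝ) → _ → ℝ) := by
  unfold momentVector
  fun_prop

/-- Small balls about the points `(k + 1, …, k + 1)` whose union has finite moments exactly up to
the order `m`. -/
theorem exists_iUnion_balls_moments {n : ℕ} (hn : n ≠ 0) (m : ℕ) {η : ℝ} (hη : 0 < η) :
    ∃ r : ℕ → ℝ, (∀ k, 0 < r k) ∧
      ∫⁻ t in ⋃ k : ℕ, Metric.ball (fun _ => (k + 1 : ℝ)) (r k), ENNReal.ofReal ((1 + ‖t‖) ^ m)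
        ∂radialMeasure n ≤ ENNReal.ofReal η ∧
      ∀ α : Fin n → ℕ, m < ∑ j, α j →
        ∫⁻ t in ⋃ k : ℕ, Metric.ball (fun _ => (k + 1 : ℝ)) (r k), ∏ j, ‖t j‖ₑ ^ α j
          ∂radialMeasure n = ⊤ := by
  have hsum : Summable fun k : ℕ => 1 / ((k : ℝ) + 1) ^ 2 := by
    have := (summable_nat_add_iff 1).2 (Real.summable_one_div_nat_pow.2 (one_lt_two : 1 < 2))
    simpa using this
  let Z : ℝ := ∑' k : ℕ, 1 / ((k : ℝ) + 1) ^ 2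
  have hZ : 0 ≤ Z := tsum_nonneg fun k => by positivity
  let δ : ℝ := min 1 (η / (3 ^ m * (Z + 1)))
  have hδ : 0 < δ := lt_min one_pos (by positivity)
  have hδZ : 3 ^ m * δ * Z ≤ η := by
    calc 3 ^ m * δ * Z ≤ 3 ^ m * (η / (3 ^ m * (Z + 1))) * (Z + 1) := by
          gcongr
          · exact min_le_right _ _
          · linarith
      _ = η := by field_simp
  -- With volume `δ / (k+1)^(m+2)`, the ball contributes to a moment of order `d` a quantity
  -- comparable to `(k+1)^(d-m-2)`: at most `1/k²` for `d ≤ m`, at least `1/k` for `d > m`. The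
  -- factor `3 ^ m` in `δ` comes from `1 + ‖t‖ ≤ 3 (k + 1)` on the ball.
  have hr : ∀ k : ℕ, ∃ r, 0 < r ∧ r ≤ 1 / 2 ∧ ∀ p : Fin n → ℝ, (∀ j, 1 ≤ p j) →
      radialMeasure n (Metric.ball p r) = ENNReal.ofReal (δ / ((k : ℝ) + 1) ^ (m + 2)) := by
    intro k
    have h1 : (1 : ℝ) ≤ ((k : ℝ) + 1) ^ (m + 2) := one_le_pow₀ (by linarith [k.cast_nonneg (α := ℝ)])
    refine exists_radialMeasure_ball_eq hn (by positivity) ?_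
    rw [div_le_one (by positivity)]
    exact (min_le_left _ _).trans h1
  choose r hr0 hr1 hrv using hr
  have hb : ∀ k : ℕ, radialMeasure n (Metric.ball (fun _ => (k + 1 : ℝ)) (r k)) =
      ENNReal.ofReal (δ / ((k : ℝ) + 1) ^ (m + 2)) := fun k =>
    hrv k _ fun _ => by linarith [k.cast_nonneg (α := ℝ)]
  have hmem : ∀ (k : ℕ) (t : Fin n → ℝ), t ∈ Metric.ball (fun _ => (k + 1 : ℝ)) (r k) →
      ∀ j, |t j - (k + 1)| < 1 / 2 := by
    intro k t ht j
    have := (dist_le_pi_dist t (fun _ => (k + 1 : ℝ)) j).trans_lt (Metric.mem_ball.1 ht)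
    rw [Real.dist_eq] at this
    exact this.trans_le (hr1 k)
  refine ⟨r, hr0, ?_, fun α hα => ?_⟩
  · calc _ ≤ ∑' k : ℕ, ∫⁻ t in Metric.ball (fun _ => (k + 1 : ℝ)) (r k),
          ENNReal.ofReal ((1 + ‖t‖) ^ m) ∂radialMeasure n := lintegral_iUnion_le _ _
      _ ≤ ∑' k : ℕ, ENNReal.ofReal (3 ^ m * δ * (1 / ((k : ℝ) + 1) ^ 2)) := by
          refine ENNReal.tsum_le_tsum fun k => ?_
          have hk : (0 : ℝ) ≤ k := k.cast_nonneg
          calc _ ≤ ∫⁻ t in Metric.ball (fun _ => (k + 1 : ℝ)) (r k),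
                ENNReal.ofReal ((3 * ((k : ℝ) + 1)) ^ m) ∂radialMeasure n := by
                refine setLIntegral_mono' Metric.isOpen_ball.measurableSet fun t ht => ?_
                have hnorm : ‖t‖ ≤ k + 2 := by
                  refine (pi_norm_le_iff_of_nonneg (by positivity)).2 fun j => ?_
                  have := abs_lt.1 (hmem k t ht j)
                  rw [Real.norm_eq_abs, abs_le]
                  constructor <;> linarith
                refine ENNReal.ofReal_le_ofReal (pow_le_pow_left₀ (by positivity) ?_ _)
                linarith
            _ = ENNReal.ofReal (3 ^ m * δ * (1 / ((k : ℝ) + 1) ^ 2)) := by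
                rw [setLIntegral_const, hb, ← ENNReal.ofReal_mul (by positivity)]
                congr 1
                rw [mul_pow, pow_add]
                field_simp
      _ = ENNReal.ofReal (3 ^ m * δ * Z) := by
          rw [← ENNReal.ofReal_tsum_of_nonneg (fun k => by positivity) (hsum.mul_left _),
            tsum_mul_left]
      _ ≤ ENNReal.ofReal η := ENNReal.ofReal_le_ofReal hδZ
  · have hdisj : Pairwise (Function.onFun Disjoint fun k : ℕ =>
        Metric.ball (fun _ : Fin n => (k + 1 : ℝ)) (r k)) := by
      have key : ∀ k l : ℕ, k < l → Disjoint (Metric.ball (fun _ : Fin n => (k + 1 : ℝ)) (r k))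
          (Metric.ball (fun _ : Fin n => (l + 1 : ℝ)) (r l)) := by
        intro k l hkl
        rw [Set.disjoint_left]
        intro t h1 h2
        have h3 := abs_lt.1 (hmem k t h1 ⟨0, Nat.pos_of_ne_zero hn⟩)
        have h4 := abs_lt.1 (hmem l t h2 ⟨0, Nat.pos_of_ne_zero hn⟩)
        have h5 : (k : ℝ) + 1 ≤ l := by exact_mod_cast hkl
        linarith
      intro k l hkl
      rcases lt_or_gt_of_ne hkl with h | h
      · exact key k l h
      · exact (key l k h).symm
    rw [lintegral_iUnion (fun k => Metric.isOpen_ball.measurableSet) hdisj, eq_top_iff]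
    -- On the `k`-th ball every coordinate is at least `(k + 1) / 2`, so the series dominates a
    -- multiple of the harmonic series.
    have hle : ∑' k : ℕ, ENNReal.ofReal ((1 / 2) ^ (∑ j, α j) * δ * (1 / ((k : ℝ) + 1))) ≤
        ∑' k : ℕ, ∫⁻ t in Metric.ball (fun _ => (k + 1 : ℝ)) (r k), ∏ j, ‖t j‖ₑ ^ α j
          ∂radialMeasure n := by
      refine ENNReal.tsum_le_tsum fun k => ?_
      have hk : (0 : ℝ) ≤ k := k.cast_nonneg
      calc ENNReal.ofReal ((1 / 2) ^ (∑ j, α j) * δ * (1 / ((k : ℝ) + 1)))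
          ≤ ∫⁻ t in Metric.ball (fun _ => (k + 1 : ℝ)) (r k),
            ENNReal.ofReal (((1 / 2) * ((k : ℝ) + 1)) ^ (∑ j, α j)) ∂radialMeasure n := by
            rw [setLIntegral_const, hb, ← ENNReal.ofReal_mul (by positivity)]
            refine ENNReal.ofReal_le_ofReal ?_
            rw [mul_pow]
            have h1 : ((k : ℝ) + 1) ^ (m + 1) ≤ ((k : ℝ) + 1) ^ (∑ j, α j) :=
              pow_le_pow_right₀ (by linarith) hα
            have h2 : 1 / ((k : ℝ) + 1) = ((k : ℝ) + 1) ^ (m + 1) / ((k : ℝ) + 1) ^ (m + 2) := by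
              rw [pow_succ _ (m + 1)]
              field_simp
            calc (1 / 2) ^ (∑ j, α j) * δ * (1 / ((k : ℝ) + 1))
                = (1 / 2) ^ (∑ j, α j) * ((k : ℝ) + 1) ^ (m + 1) *
                  (δ / ((k : ℝ) + 1) ^ (m + 2)) := by rw [h2]; ring
              _ ≤ _ := by gcongr
        _ ≤ _ := by
            refine setLIntegral_mono' Metric.isOpen_ball.measurableSet fun t ht => ?_
            rw [ENNReal.ofReal_pow (by positivity), ← Finset.prod_pow_eq_pow_sum]
            refine Finset.prod_le_prod' fun j _ => ?_
            gcongr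
            rw [← ofReal_norm, Real.norm_eq_abs]
            refine ENNReal.ofReal_le_ofReal ?_
            have := abs_lt.1 (hmem k t ht j)
            have := le_abs_self (t j)
            linarith
    refine le_trans (top_le_iff.2 ?_) hle
    by_contra hne
    have h1 := ENNReal.summable_toReal hne
    have hc : (0 : ℝ) < (1 / 2) ^ (∑ j, α j) * δ := by positivity
    have h2 : Summable fun k : ℕ => (1 / 2) ^ (∑ j, α j) * δ * (1 / ((k : ℝ) + 1)) := by
      refine h1.congr fun k => ?_
      rw [ENNReal.toReal_ofReal (by positivity)]
    have h3 := (summable_mul_left_iff hc.ne').1 h2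
    refine Real.not_summable_one_div_natCast ((summable_nat_add_iff 1).1 ?_)
    simpa using h3

/-- A thin neighborhood of a comb with finite moments exactly up to the order `m`. -/
theorem exists_isUnionOfBallsAt_comb {n : ℕ} (hn : n ≠ 0) (m : ℕ) (i j : Fin n) {Λ : Set ℝ}
    (hΛ : Λ.Countable) (hΛn : ∀ k : ℕ, (k + 1 : ℝ) ∈ Λ) {η : ℝ} (hη : 0 < η) :
    ∃ B : Set (Fin n → ℝ), IsUnionOfBallsAt (comb i j Λ) B ∧
      ∫⁻ t in B, ENNReal.ofReal ((1 + ‖t‖) ^ m) ∂radialMeasure n ≤ ENNReal.ofReal η ∧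
      ∀ α : Fin n → ℕ, m < ∑ j, α j → ∫⁻ t in B, ∏ j, ‖t j‖ₑ ^ α j ∂radialMeasure n = ⊤ := by
  obtain ⟨r, -, hr1, hr2⟩ := exists_iUnion_balls_moments hn m (half_pos hη)
  -- The weight `(1 + ‖t‖)^m` dominates all moments up to order `m`. The comb is null for the
  -- weighted measure, so outer regularity provides an open neighborhood of mass below `η / 2`,
  -- although the comb is unbounded.
  have hlf : IsLocallyFiniteMeasure ((radialMeasure n).withDensity fun t =>
      ENNReal.ofReal ((1 + ‖t‖) ^ m)) := IsLocallyFiniteMeasure.withDensity_ofReal (by fun_prop)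
  have hnull : ((radialMeasure n).withDensity fun t => ENNReal.ofReal ((1 + ‖t‖) ^ m))
      (comb i j Λ) = 0 :=
    withDensity_absolutelyContinuous _ _ (radialMeasure_comb i j hΛ)
  obtain ⟨U, hcU, hU, hUη⟩ := Set.exists_isOpen_lt_of_lt (comb i j Λ)
    (ENNReal.ofReal (η / 2)) (by rw [hnull]; exact ENNReal.ofReal_pos.2 (half_pos hη))
  obtain ⟨D, hDU, hD⟩ := IsUnionOfBallsAt.exists_subset hU hcU
  refine ⟨_, hD.union_iUnion (fun (k : ℕ) _ => (k + 1 : ℝ)) r fun k =>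
    ⟨fun _ => by positivity, Or.inr (hΛn k)⟩, ?_, fun α hα => ?_⟩
  · have h1 : ∫⁻ t in D, ENNReal.ofReal ((1 + ‖t‖) ^ m) ∂radialMeasure n ≤
        ENNReal.ofReal (η / 2) := by
      rw [← withDensity_apply _ hD.isOpen.measurableSet]
      exact (measure_mono hDU).trans hUη.le
    calc _ ≤ _ := lintegral_union_le _ _ _
      _ ≤ ENNReal.ofReal (η / 2) + ENNReal.ofReal (η / 2) := add_le_add h1 hr1
      _ = ENNReal.ofReal η := by
        rw [← ENNReal.ofReal_add (half_pos hη).le (half_pos hη).le, add_halves]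
  · rw [eq_top_iff, ← hr2 α hα]
    exact lintegral_mono_set Set.subset_union_right

/-- For each small `ε` there is a neighborhood of a comb whose moments up to the order `m` are `ε`
times those of the Fubini–Study measure and whose higher moments are infinite. -/
theorem exists_isUnionOfBallsAt_setIntegral_eq {n : ℕ} (m : ℕ) {i j : Fin n} :
    ∃ ε₀ : ℝ, 0 < ε₀ ∧ ∀ ε : ℝ, 0 < ε → ε < ε₀ → ∃ (Λ : Set ℝ) (D : Set (Fin n → ℝ)),
      (∀ k : ℕ, (k + 1 : ℝ) ∈ Λ) ∧ IsUnionOfBallsAt (comb i j Λ) D ∧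
      IntegrableOn (momentVector m) D (radialMeasure n) ∧
      ∫ t in D, momentVector m t ∂radialMeasure n =
        ε • (fun b => ∏ i, ((b.1 i).factorial : ℝ)) ∧
      ∀ α : Fin n → ℕ, m < ∑ j, α j → ∫⁻ t in D, ∏ j, ‖t j‖ₑ ^ α j ∂radialMeasure n = ⊤ := by
  have hn : n ≠ 0 := fun h => by subst h; exact i.elim0
  obtain ⟨S, w, hS, hw, hc, hspan⟩ := exists_cubature n m
  -- Balls of radius at most `R` about the nodes stay in the orthant, where the volume formula
  -- holds.
  obtain ⟨R, hR, hRS⟩ : ∃ R, 0 < R ∧ ∀ p ∈ S, ∀ k, R ≤ p k := by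
    have : ∀ᶠ R : ℝ in nhdsWithin 0 (Set.Ioi 0), ∀ p ∈ S, ∀ k, R ≤ p k :=
      (Filter.eventually_all_finset S).2 fun p hp => Filter.eventually_all.2 fun k => by
        filter_upwards [Ioc_mem_nhdsGT (hS p hp k)] with R hR using hR.2
    obtain ⟨R, h1, h2⟩ := (this.and self_mem_nhdsWithin).exists
    exact ⟨R, h2, h1⟩
  have hpi := Real.pi_pos
  obtain ⟨η, hη, ε₀, hε₀, H⟩ := exists_union_balls_setIntegral_eq (ν := radialMeasure n)
    (continuous_momentVector n m) hw (c := fun b => ∏ i, ((b.1 i).factorial : ℝ))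
    (by ext b; simpa [Finset.sum_apply] using hc b) hspan
    (φ := fun r => (2 * Real.pi * r) ^ n) (by fun_prop) (fun r hr => by positivity)
    (fun r hr => by positivity) hR
    (fun p hp r h0 h1 => radialMeasure_ball hn h0 fun k => h1.trans (hRS p hp k))
  refine ⟨ε₀, hε₀, fun ε hε hεε₀ => ?_⟩
  -- The teeth pass through the diagonal points `(k+1, …, k+1)` and through all cubature nodes, so
  -- that the balls about them are attached to the comb.
  let Λ : Set ℝ := Set.range (fun k : ℕ => (k + 1 : ℝ)) ∪ (fun p : Fin n → ℝ => p i) '' S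
  have hΛ : Λ.Countable := (Set.countable_range _).union (S.countable_toSet.image _)
  obtain ⟨B, hB, hBη, hBinf⟩ := exists_isUnionOfBallsAt_comb hn m i j hΛ
    (fun k => Or.inl ⟨k, rfl⟩) (mul_pos hε hη)
  have henorm : ∀ t : Fin n → ℝ, ‖momentVector m t‖ₑ ≤ ENNReal.ofReal ((1 + ‖t‖) ^ m) := fun t => by
    rw [← ofReal_norm]
    exact ENNReal.ofReal_le_ofReal (norm_momentVector_le t)
  have hle : ∫⁻ t in B, ‖momentVector m t‖ₑ ∂radialMeasure n ≤ ENNReal.ofReal (ε * η) :=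
    (lintegral_mono henorm).trans hBη
  obtain ⟨r, -, hrint, hreq⟩ := H ε hε hεε₀ B hB.isOpen.measurableSet
    ⟨(continuous_momentVector n m).aestronglyMeasurable, hle.trans_lt ENNReal.ofReal_lt_top⟩
    (by
      refine le_trans ?_ hBη
      rw [← setLIntegral_one]
      refine lintegral_mono fun t => ?_
      rw [← ENNReal.ofReal_one]
      exact ENNReal.ofReal_le_ofReal (one_le_pow₀ (by linarith [norm_nonneg t])))
    (by
      refine (norm_integral_le_lintegral_norm _).trans ?_
      refine ENNReal.toReal_le_of_le_ofReal (by positivity) ?_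
      simpa only [ofReal_norm] using hle)
  have hunion : B ∪ ⋃ p ∈ S, Metric.ball p (r p) =
      B ∪ ⋃ p : S, Metric.ball p.1 (r p) := by
    congr 1
    exact Set.biUnion_eq_iUnion (S : Set (Fin n → ℝ)) fun p _ => Metric.ball p (r p)
  refine ⟨Λ, _, fun k => Or.inl ⟨k, rfl⟩, ?_, hrint, hreq, fun α hα => ?_⟩
  · rw [hunion]
    exact hB.union_iUnion _ _ fun p => ⟨fun k => (hS p p.2 k).le, Or.inr (Or.inr ⟨p, p.2, rfl⟩)⟩
  · rw [eq_top_iff, ← hBinf α hα]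
    exact lintegral_mono_set Set.subset_union_left

/-! ### From sets of squared moduli to Reinhardt domains -/

theorem enorm_finset_prod {ι : Type*} (s : Finset ι) (f : ι → ℂ) :
    ‖∏ i ∈ s, f i‖ₑ = ∏ i ∈ s, ‖f i‖ₑ := by
  classical
  induction s using Finset.induction_on with
  | empty => simp
  | insert i s hi ih => rw [Finset.prod_insert hi, Finset.prod_insert hi, enorm_mul, ih]

section RadialPreimage

variable {n : ℕ} {D : Set (Fin n → ℝ)}

theorem isReinhardt_preimage_radialMap (D : Set (Fin n → ℝ)) :
    IsReinhardt (radialMap n ⁻¹' D) := by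
  intro z hz u hu
  have : radialMap n (fun j => u j * z j) = radialMap n z := by
    ext j
    simp [radialMap, hu j]
  rwa [Set.mem_preimage, this]

theorem radialMap_sqrt_mul_exp {t : Fin n → ℝ} (ht : ∀ j, 0 ≤ t j) (θ : Fin n → ℝ) :
    radialMap n (fun j => (√(t j) : ℂ) * Complex.exp (θ j * Complex.I)) = t := by
  ext j
  rw [radialMap, norm_mul, Complex.norm_exp_ofReal_mul_I, mul_one, Complex.norm_real,
    Real.norm_of_nonneg (Real.sqrt_nonneg _), Real.sq_sqrt (ht j)]

/-- Polar coordinates exhibit the preimage as a continuous image of a product with the space of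
angles. Only the part of `D` in the orthant is seen by `radialMap`. -/
theorem isPreconnected_preimage_radialMap
    (hD : IsPreconnected (D ∩ {t | ∀ j, 0 ≤ t j})) : IsPreconnected (radialMap n ⁻¹' D) := by
  let Φ : (Fin n → ℝ) × (Fin n → ℝ) → Fin n → ℂ := fun p j =>
    (√(p.1 j) : ℂ) * Complex.exp (p.2 j * Complex.I)
  have hΦ : Continuous Φ := by fun_prop
  have himg : radialMap n ⁻¹' D = Φ '' ((D ∩ {t | ∀ j, 0 ≤ t j}) ×ˢ Set.univ) := by
    ext z
    constructor
    · intro hz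
      refine ⟨(radialMap n z, fun j => (z j).arg), ⟨⟨hz, fun j => sq_nonneg _⟩, trivial⟩, ?_⟩
      ext j
      simp only [Φ, radialMap, Real.sqrt_sq (norm_nonneg _)]
      exact Complex.norm_mul_exp_arg_mul_I (z j)
    · rintro ⟨p, ⟨⟨hp, hp0⟩, -⟩, rfl⟩
      have := radialMap_sqrt_mul_exp hp0 p.2
      exact Set.mem_preimage.2 (this.symm ▸ hp)
  rw [himg]
  exact (hD.prod isPreconnected_univ).image _ hΦ.continuousOn

theorem lintegral_monomial_preimage_radialMap (hD : MeasurableSet D) (α : Fin n → ℕ) :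
    ∫⁻ z in radialMap n ⁻¹' D, ‖∏ j, z j ^ α j‖ₑ ^ 2 =
      ∫⁻ t in D, ∏ j, ‖t j‖ₑ ^ α j ∂radialMeasure n := by
  rw [← (measurePreserving_radialMap n).setLIntegral_comp_preimage hD
    (f := fun t => ∏ j, ‖t j‖ₑ ^ α j) (by fun_prop)]
  refine lintegral_congr fun z => ?_
  simp only [radialMap, enorm_finset_prod, enorm_pow, enorm_norm, ← Finset.prod_pow, ← pow_mul, mul_comm]

theorem integral_monomial_mul_conj_preimage_radialMap {m : ℕ} (hD : MeasurableSet D)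
    (b : Finset.piAntidiag (Finset.univ : Finset (Fin (n + 1))) m) :
    ∫ z in radialMap n ⁻¹' D, (∏ j, z j ^ b.1 (Fin.succ j)) * conj (∏ j, z j ^ b.1 (Fin.succ j)) =
      ((∫ t in D, momentVector m t b ∂radialMeasure n : ℝ) : ℂ) := by
  have hmp := (measurePreserving_radialMap n).restrict_preimage hD
  have hc : Continuous fun t : Fin n → ℝ => momentVector m t b :=
    (continuous_apply b).comp (continuous_momentVector n m)
  rw [← hmp.map_eq, integral_map hmp.measurable.aemeasurable hc.aestronglyMeasurable,
    ← integral_complex_ofReal]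
  refine integral_congr_ae (Filter.Eventually.of_forall fun z => ?_)
  simp only [momentVector, radialMap]
  rw [Complex.mul_conj']
  push_cast [norm_prod, norm_pow]
  rw [← Finset.prod_pow]
  exact Finset.prod_congr rfl fun j _ => by ring

end RadialPreimage

/-! ### Orthogonality of monomials and the multinomial expansion -/

/-- Different monomials are orthogonal on a Reinhardt domain. -/
theorem bergmanInner_monomialOn_of_ne {n : ℕ} {Ω : Set (Fin n → ℂ)} (hO : IsOpen Ω)
    (hΩ : IsReinhardt Ω) {α β : Fin n → ℕ} (h : α ≠ β) :
    bergmanInner Ω (monomialOn Ω α) (monomialOn Ω β) = 0 := by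
  obtain ⟨j, hj⟩ := Function.ne_iff.1 h
  let g : (Fin n → ℂ) → ℂ := fun z => (∏ i, z i ^ α i) * conj (∏ i, z i ^ β i)
  have hgc : Continuous g := by fun_prop
  -- Rotating the `j`-th coordinate by the angle `π / d` changes the sign of `z^α conj(z^β)` and
  -- preserves `Ω` and its measure, so the integral equals its own negative.
  let d : ℤ := α j - β j
  have hd : (d : ℂ) ≠ 0 := by
    rw [Int.cast_ne_zero]
    simp only [d]
    omega
  let u : ℂ := Complex.exp ((Real.pi / d : ℝ) * Complex.I)
  have hu : ‖u‖ = 1 := Complex.norm_exp_ofReal_mul_I _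
  have hu0 : u ≠ 0 := Complex.exp_ne_zero _
  have hud : u ^ d = -1 := by
    rw [← Complex.exp_int_mul, ← Complex.exp_pi_mul_I]
    congr 1
    push_cast
    field_simp
  have hconj : u ^ α j * conj u ^ β j = -1 := by
    have hcu : conj u = u⁻¹ := by
      rw [Complex.inv_def, Complex.normSq_eq_norm_sq, hu]
      simp
    rw [hcu, inv_pow, ← hud, zpow_sub₀ hu0, zpow_natCast, zpow_natCast, div_eq_mul_inv]
  let U : Fin n → ℂ := Function.update 1 j u
  have hU : ∀ i, ‖U i‖ = 1 := fun i => by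
    rcases eq_or_ne i j with rfl | hij
    · simp [U, hu]
    · simp [U, hij]
  have hUprod : ∀ γ : Fin n → ℕ, ∏ i, U i ^ γ i = u ^ γ j := fun γ => by
    rw [Finset.prod_eq_single j]
    · simp [U]
    · intro i _ hij
      simp [U, hij]
    · simp
  have hgU : ∀ z, g (fun i => U i * z i) = -g z := fun z => by
    simp only [g, mul_pow, Finset.prod_mul_distrib, map_mul, hUprod, map_pow]
    linear_combination (∏ i, z i ^ α i) * conj (∏ i, z i ^ β i) * hconj
  have hmp := measurePreserving_mul_of_norm_eq_one U hU
  have hpre : (fun z : Fin n → ℂ => fun i => U i * z i) ⁻¹' Ω = Ω := by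
    ext z
    refine ⟨fun hz => ?_, fun hz => hΩ z hz U hU⟩
    have := hΩ _ hz (fun i => (U i)⁻¹) fun i => by rw [norm_inv, hU, inv_one]
    convert this using 1
    ext i
    have : U i ≠ 0 := norm_ne_zero_iff.1 (by rw [hU]; exact one_ne_zero)
    field_simp
  have hres := hmp.restrict_preimage hO.measurableSet
  rw [hpre] at hres
  have hkey : ∫ z in Ω, g z = -∫ z in Ω, g z := by
    nth_rw 1 [← hres.map_eq]
    rw [integral_map hres.measurable.aemeasurable hgc.aestronglyMeasurable, ← integral_neg]
    simp only [hgU]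
  have : bergmanInner Ω (monomialOn Ω α) (monomialOn Ω β) = ∫ z in Ω, g z :=
    integral_lebesgueOn hO g
  rw [this]
  exact self_eq_neg.1 hkey

theorem bergmanInner_smul_smul {n : ℕ} {Ω : Set (Fin n → ℂ)} (a b : ℂ) (f g : Ω → ℂ) :
    bergmanInner Ω (a • f) (b • g) = a * conj b * bergmanInner Ω f g := by
  simp only [bergmanInner, Pi.smul_apply, smul_eq_mul, map_mul]
  rw [← integral_const_mul]
  exact integral_congr_ae (Filter.Eventually.of_forall fun z => by simp only; ring)

theorem bergmanInner_sum_left {n : ℕ} {Ω : Set (Fin n → ℂ)} {ι : Type*} (s : Finset ι)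
    {f : ι → Ω → ℂ} {g : Ω → ℂ} (hf : ∀ i ∈ s, f i ∈ bergmanSpace Ω) (hg : g ∈ bergmanSpace Ω) :
    bergmanInner Ω (∑ i ∈ s, f i) g = ∑ i ∈ s, bergmanInner Ω (f i) g := by
  simp only [bergmanInner, Finset.sum_apply, Finset.sum_mul]
  refine integral_finsetSum _ fun i hi => ?_
  exact (hf i hi).2.integrable_mul hg.2.star

/-- A finite orthonormal family that spans the Bergman space is an orthonormal basis. -/
theorem IsBergmanBasis.of_span_eq {n : ℕ} {Ω : Set (Fin n → ℂ)} {ι : Type} [Fintype ι]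
    [DecidableEq ι] {φ : ι → Ω → ℂ} (hspan : bergmanSpace Ω = Submodule.span ℂ (Set.range φ))
    (h : ∀ j k, bergmanInner Ω (φ j) (φ k) = if j = k then 1 else 0) : IsBergmanBasis Ω φ where
  mem k := by
    rw [hspan]
    exact Submodule.subset_span ⟨k, rfl⟩
  norm_eq_one k := by rw [h, if_pos rfl]
  orthogonal j k hjk := by rw [h, if_neg hjk]
  total f hf h0 := by
    have hmem : ∀ k, φ k ∈ bergmanSpace Ω := fun k => by
      rw [hspan]
      exact Submodule.subset_span ⟨k, rfl⟩
    rw [hspan] at hf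
    obtain ⟨a, rfl⟩ := (Submodule.mem_span_range_iff_exists_fun ℂ).1 hf
    have ha : ∀ k, a k = 0 := fun k => by
      have := h0 k
      rw [bergmanInner_sum_left _ (fun i _ => Submodule.smul_mem _ _ (hmem i)) (hmem k)] at this
      have e : ∀ i, bergmanInner Ω (a i • φ i) (φ k) = if i = k then a i else 0 := fun i => by
        have := bergmanInner_smul_smul (a i) 1 (φ i) (φ k)
        rw [one_smul] at this
        rw [this, h]
        simp
      simpa [e] using this
    simp [ha]

/-- Homogenization: the exponent of the additional variable is `m - |α|`. -/
theorem setOf_monomialOn_eq_range {n : ℕ} (m : ℕ) (Ω : Set (Fin n → ℂ)) :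
    {f : Ω → ℂ | ∃ α : Fin n → ℕ, ∑ j, α j ≤ m ∧ f = monomialOn Ω α} =
      Set.range fun b : Finset.piAntidiag (Finset.univ : Finset (Fin (n + 1))) m =>
        monomialOn Ω fun j => b.1 (Fin.succ j) := by
  ext f
  constructor
  · rintro ⟨α, hα, rfl⟩
    refine ⟨⟨Fin.cons (m - ∑ j, α j) α, ?_⟩, ?_⟩
    · rw [Finset.mem_piAntidiag, Fin.sum_univ_succ]
      simp [Nat.sub_add_cancel hα]
    · simp
  · rintro ⟨b, rfl⟩
    refine ⟨_, ?_, rfl⟩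
    have hb := (Finset.mem_piAntidiag.1 b.2).1
    rw [Fin.sum_univ_succ] at hb
    exact (Nat.le_add_left _ _).trans_eq hb

theorem piAntidiag_ext_succ {n m : ℕ}
    {b c : Finset.piAntidiag (Finset.univ : Finset (Fin (n + 1))) m}
    (h : (fun j : Fin n => b.1 (Fin.succ j)) = fun j : Fin n => c.1 (Fin.succ j)) : b = c := by
  have hb := (Finset.mem_piAntidiag.1 b.2).1
  have hc := (Finset.mem_piAntidiag.1 c.2).1
  rw [Fin.sum_univ_succ] at hb hc
  have hs : ∑ j : Fin n, b.1 (Fin.succ j) = ∑ j : Fin n, c.1 (Fin.succ j) :=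
    Finset.sum_congr rfl fun j _ => congrFun h j
  refine Subtype.ext (funext fun i => ?_)
  refine Fin.cases ?_ (fun j => congrFun h j) i
  omega

/-- The multinomial theorem for the `n + 1` quantities `1, a₁, …, aₙ`. -/
theorem one_add_sum_pow_eq {n : ℕ} (m : ℕ) (a : Fin n → ℂ) :
    (1 + ∑ j, a j) ^ m = ∑ b : Finset.piAntidiag (Finset.univ : Finset (Fin (n + 1))) m,
      ((m.factorial : ℂ) / ∏ i, ((b.1 i).factorial : ℂ)) * ∏ j, a j ^ b.1 (Fin.succ j) := by
  have h := Finset.sum_pow_eq_sum_piAntidiag (Finset.univ : Finset (Fin (n + 1)))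
    (Fin.cons 1 a : Fin (n + 1) → ℂ) m
  rw [Fin.sum_univ_succ] at h
  simp only [Fin.cons_zero, Fin.cons_succ] at h
  rw [h, ← Finset.sum_coe_sort]
  refine Finset.sum_congr rfl fun b _ => ?_
  have hb := (Finset.mem_piAntidiag.1 b.2).1
  have hm := Nat.multinomial_spec (Finset.univ : Finset (Fin (n + 1))) b.1
  rw [hb] at hm
  have hne : (∏ i, ((b.1 i).factorial : ℂ)) ≠ 0 :=
    Finset.prod_ne_zero_iff.2 fun i _ => by exact_mod_cast Nat.factorial_ne_zero _
  have hm' : (∏ i, ((b.1 i).factorial : ℂ)) * (Nat.multinomial Finset.univ b.1 : ℂ) =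
      m.factorial := by exact_mod_cast hm
  rw [Fin.prod_univ_succ]
  simp only [Fin.cons_zero, Fin.cons_succ, one_pow, one_mul]
  congr 1
  rw [eq_div_iff hne, mul_comm, hm']

/-! ### The metric of the potential `log (C (1 + ‖z‖²)^m)` -/

section Metric

variable {n : ℕ}

/-- The real derivative of `z ↦ ∑ⱼ ‖zⱼ‖²`. -/
noncomputable def sumNormSqDeriv (z : Fin n → ℂ) : (Fin n → ℂ) →L[ℝ] ℝ :=
  ∑ j, (2 • innerSL ℝ (z j)).comp (ContinuousLinearMap.proj j)

theorem sumNormSqDeriv_single (z : Fin n → ℂ) (j : Fin n) (a : ℂ) :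
    sumNormSqDeriv z (Pi.single j a) = 2 * (conj (z j) * a).re := by
  rw [sumNormSqDeriv, sum_apply, Finset.sum_eq_single j]
  · simp [Complex.inner, mul_comm]
    ring
  · intro i _ hij
    simp [hij]
  · simp

theorem hasFDerivAt_sum_norm_sq (z : Fin n → ℂ) :
    HasFDerivAt (fun x : Fin n → ℂ => ∑ j, ‖x j‖ ^ 2) (sumNormSqDeriv z) z := by
  refine HasFDerivAt.fun_sum fun j _ => ?_
  exact (hasStrictFDerivAt_norm_sq (z j)).hasFDerivAt.comp z
    (ContinuousLinearMap.proj (R := ℝ) (φ := fun _ : Fin n => ℂ) j).hasFDerivAt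

theorem one_add_sum_norm_sq_pos (z : Fin n → ℂ) : 0 < 1 + ∑ j, ‖z j‖ ^ 2 := by positivity

theorem wirtingerBar_log {C : ℝ} (hC : 0 < C) (m : ℕ) (k : Fin n) (z : Fin n → ℂ) :
    wirtingerBar k (fun x => ((Real.log (C * (1 + ∑ j, ‖x j‖ ^ 2) ^ m) : ℝ) : ℂ)) z =
      m * (z k / ((1 + ∑ j, ‖z j‖ ^ 2 : ℝ) : ℂ)) := by
  have hlog : ∀ x : Fin n → ℂ, Real.log (C * (1 + ∑ j, ‖x j‖ ^ 2) ^ m) =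
      Real.log C + m * Real.log (1 + ∑ j, ‖x j‖ ^ 2) := fun x => by
    have := one_add_sum_norm_sq_pos x
    rw [Real.log_mul hC.ne' (by positivity), Real.log_pow]
  have hpos := one_add_sum_norm_sq_pos z
  have h1 := ((((hasFDerivAt_sum_norm_sq z).const_add 1).log hpos.ne').const_mul
    (m : ℝ)).const_add (Real.log C)
  have h2 := Complex.ofRealCLM.hasFDerivAt.comp z h1
  have h3 : fderiv ℝ (fun x : Fin n → ℂ => ((Real.log C + m * Real.log (1 + ∑ j, ‖x j‖ ^ 2) : ℝ) : ℂ))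
    z = _ := h2.fderiv
  have hne : ((1 + ∑ j, ‖z j‖ ^ 2 : ℝ) : ℂ) ≠ 0 := by exact_mod_cast hpos.ne'
  simp only [hlog]
  rw [wirtingerBar, h3]
  simp only [ContinuousLinearMap.comp_apply, smul_apply,
    sumNormSqDeriv_single, Complex.ofRealCLM_apply, smul_eq_mul]
  generalize (1 + ∑ j, ‖z j‖ ^ 2 : ℝ) = s at hne
  have e1 : (conj (z k) * 1).re = (z k).re := by simp
  have e2 : (conj (z k) * Complex.I).re = (z k).im := by simp
  rw [e1, e2]
  nth_rw 3 [← Complex.re_add_im (z k)]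
  push_cast
  field_simp

theorem wirtinger_div_one_add_sum (m : ℕ) (j k : Fin n) (z : Fin n → ℂ) :
    wirtinger j (fun x => m * (x k / ((1 + ∑ j, ‖x j‖ ^ 2 : ℝ) : ℂ))) z =
      m * ((if j = k then 1 else 0) / ((1 + ∑ j, ‖z j‖ ^ 2 : ℝ) : ℂ) -
        z k * conj (z j) / ((1 + ∑ j, ‖z j‖ ^ 2 : ℝ) : ℂ) ^ 2) := by
  have hpos := one_add_sum_norm_sq_pos z
  have hne : ((1 + ∑ j, ‖z j‖ ^ 2 : ℝ) : ℂ) ≠ 0 := by exact_mod_cast hpos.ne'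
  have h1 := Complex.ofRealCLM.hasFDerivAt.comp z
    ((hasDerivAt_inv hpos.ne').comp_hasFDerivAt z ((hasFDerivAt_sum_norm_sq z).const_add 1))
  have h2 := ((ContinuousLinearMap.proj (R := ℝ) (φ := fun _ : Fin n => ℂ) k).hasFDerivAt
    (x := z)).mul h1
  have hfun : (fun x : Fin n → ℂ => (m : ℂ) * (x k / ((1 + ∑ j, ‖x j‖ ^ 2 : ℝ) : ℂ))) =
      fun x => (m : ℂ) * (x k * (((1 + ∑ j, ‖x j‖ ^ 2)⁻¹ : ℝ) : ℂ)) := by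
    ext x
    rw [Complex.ofReal_inv, div_eq_mul_inv]
  have h3 : fderiv ℝ (fun x : Fin n → ℂ =>
      (m : ℂ) * (x k * (((1 + ∑ j, ‖x j‖ ^ 2)⁻¹ : ℝ) : ℂ))) z = _ := (h2.const_mul (m : ℂ)).fderiv
  rw [hfun, wirtinger, h3]
  simp only [ContinuousLinearMap.comp_apply, smul_apply,
    add_apply, ContinuousLinearMap.proj_apply, Function.comp_apply,
    sumNormSqDeriv_single, Complex.ofRealCLM_apply, smul_eq_mul]
  generalize (1 + ∑ j, ‖z j‖ ^ 2 : ℝ) = s at hne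
  have e1 : (conj (z j) * 1).re = (z j).re := by simp
  have e2 : (conj (z j) * Complex.I).re = (z j).im := by simp
  have e3 : conj (z j) = (z j).re - (z j).im * Complex.I := by
    apply Complex.ext <;> simp
  have e4 : ∀ a : ℂ, (Pi.single j a : Fin n → ℂ) k = if j = k then a else 0 := fun a => by
    simp [Pi.single_apply, eq_comm]
  rw [e1, e2, e3, e4, e4]
  split_ifs
  · push_cast
    field_simp
    ring_nf
    simp only [Complex.I_sq]
    ring
  · push_cast
    field_simp
    ring

/-- With `Z = (1, z)` one has `⟨Z, Z⟩ = 1 + ‖z‖²`, and the two terms of the second derivative become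
the two terms of `fubiniStudy`. The diagonal formula is required for all `z`, so that the
derivatives can be computed from equal functions. -/
theorem bergmanMetric_eq_fubiniStudyAffine {C : ℝ} (hC : 0 < C) (m : ℕ)
    {K : (Fin n → ℂ) → (Fin n → ℂ) → ℂ}
    (hK : ∀ z, K z z = ((C * (1 + ∑ j, ‖z j‖ ^ 2) ^ m : ℝ) : ℂ)) (z v w : Fin n → ℂ) :
    bergmanMetric K z v w = (m : ℂ) * fubiniStudyAffine z v w := by
  have hne : ((1 + ∑ j, ‖z j‖ ^ 2 : ℝ) : ℂ) ≠ 0 := by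
    exact_mod_cast (one_add_sum_norm_sq_pos z).ne'
  have hw : ∀ j k, wirtinger j (wirtingerBar k fun x => ((Real.log (K x x).re : ℝ) : ℂ)) z =
      m * ((if j = k then 1 else 0) / ((1 + ∑ j, ‖z j‖ ^ 2 : ℝ) : ℂ) -
        z k * conj (z j) / ((1 + ∑ j, ‖z j‖ ^ 2 : ℝ) : ℂ) ^ 2) := by
    intro j k
    rw [← wirtinger_div_one_add_sum]
    congr 1
    ext x
    rw [← wirtingerBar_log hC]
    simp only [hK, Complex.ofReal_re]
  have hZZ : hermitianDot (Fin.cons 1 z : Fin (n + 1) → ℂ) (Fin.cons 1 z) =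
      ((1 + ∑ j, ‖z j‖ ^ 2 : ℝ) : ℂ) := by
    simp only [hermitianDot, Fin.sum_univ_succ, Fin.cons_zero, Fin.cons_succ, Complex.mul_conj']
    push_cast
    simp
  have hVW : hermitianDot (Fin.cons 0 v : Fin (n + 1) → ℂ) (Fin.cons 0 w) =
      ∑ j, v j * conj (w j) := by
    simp [hermitianDot, Fin.sum_univ_succ]
  have hVZ : hermitianDot (Fin.cons 0 v : Fin (n + 1) → ℂ) (Fin.cons 1 z) =
      ∑ j, v j * conj (z j) := by
    simp [hermitianDot, Fin.sum_univ_succ]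
  have hZW : hermitianDot (Fin.cons 1 z : Fin (n + 1) → ℂ) (Fin.cons 0 w) =
      ∑ j, z j * conj (w j) := by
    simp [hermitianDot, Fin.sum_univ_succ]
  rw [fubiniStudyAffine, fubiniStudy, hZZ, hVW, hVZ, hZW, bergmanMetric]
  simp only [hw]
  generalize ((1 + ∑ j, ‖z j‖ ^ 2 : ℝ) : ℂ) = s at hne
  have e1 : ∀ j k : Fin n, (m : ℂ) * ((if j = k then 1 else 0) / s - z k * conj (z j) / s ^ 2) *
      v j * conj (w k) = (if j = k then m / s * (v j * conj (w k)) else 0) -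
        m / s ^ 2 * ((v j * conj (z j)) * (z k * conj (w k))) := by
    intro j k
    split_ifs <;> ring
  simp only [e1, Finset.sum_sub_distrib, Finset.sum_ite_eq, Finset.mem_univ, if_true,
    ← Finset.mul_sum, ← Finset.sum_mul]
  field_simp

end Metric

/-! ### Separation properties -/

section Separation

variable {n m : ℕ} {Ω : Set (Fin n → ℂ)}

/-- Since `m ≥ 1`, the functions `zⱼ - a` are available; they separate points and directions. -/
theorem domRestrict_affine_mem_bergmanSpace (hm : 1 ≤ m)
    (hA : bergmanSpace Ω =
      Submodule.span ℂ {f : Ω → ℂ | ∃ α : Fin n → ℕ, ∑ j, α j ≤ m ∧ f = monomialOn Ω α})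
    (j : Fin n) (a : ℂ) : Ω.domRestrict (fun z : Fin n → ℂ => z j - a) ∈ bergmanSpace Ω := by
  have h1 : monomialOn Ω 0 ∈ bergmanSpace Ω := by
    rw [hA]
    exact Submodule.subset_span ⟨0, by simp, rfl⟩
  have h2 : monomialOn Ω (Pi.single j 1) ∈ bergmanSpace Ω := by
    rw [hA]
    exact Submodule.subset_span ⟨_, by simpa using hm, rfl⟩
  convert Submodule.sub_mem _ h2 (Submodule.smul_mem _ a h1) using 1
  ext z
  simp only [Set.domRestrict_apply, monomialOn, Pi.sub_apply, Pi.smul_apply, Pi.zero_apply,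
    pow_zero, Finset.prod_const_one, smul_eq_mul, mul_one]
  rw [Finset.prod_eq_single j]
  · simp
  · intro i _ hij
    simp [hij]
  · simp

theorem bergmanBasePointFree_of_eq_span
    (hA : bergmanSpace Ω =
      Submodule.span ℂ {f : Ω → ℂ | ∃ α : Fin n → ℕ, ∑ j, α j ≤ m ∧ f = monomialOn Ω α}) :
    BergmanBasePointFree Ω := fun x => by
  refine ⟨monomialOn Ω 0, ?_, by simp [monomialOn]⟩
  rw [hA]
  exact Submodule.subset_span ⟨0, by simp, rfl⟩

theorem bergmanSeparatesPoints_of_eq_span (hm : 1 ≤ m)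
    (hA : bergmanSpace Ω =
      Submodule.span ℂ {f : Ω → ℂ | ∃ α : Fin n → ℕ, ∑ j, α j ≤ m ∧ f = monomialOn Ω α}) :
    BergmanSeparatesPoints Ω := fun x y hxy => by
  obtain ⟨j, hj⟩ := Function.ne_iff.1 fun h => hxy (Subtype.ext h)
  exact ⟨_, domRestrict_affine_mem_bergmanSpace hm hA j (x.1 j), sub_self _,
    sub_ne_zero.2 (Ne.symm hj)⟩

theorem bergmanSeparatesDirections_of_eq_span (hm : 1 ≤ m)
    (hA : bergmanSpace Ω =
      Submodule.span ℂ {f : Ω → ℂ | ∃ α : Fin n → ℕ, ∑ j, α j ≤ m ∧ f = monomialOn Ω α}) :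
    BergmanSeparatesDirections Ω := fun x _ v hv => by
  obtain ⟨j, hj⟩ := Function.ne_iff.1 hv
  refine ⟨fun z => z j - x j, by fun_prop, domRestrict_affine_mem_bergmanSpace hm hA j (x j),
    sub_self _, ?_⟩
  have h := ((ContinuousLinearMap.proj (R := ℂ) (φ := fun _ : Fin n => ℂ) j).hasFDerivAt
    (x := x)).sub_const (x j)
  have h' : fderiv ℂ (fun z : Fin n → ℂ => z j - x j) x = _ := h.fderiv
  rw [h']
  exact hj

end Separation

/-! ### The Bergman kernel and the main theorem -/

/-- The Bergman kernel of a Reinhardt domain on which the norms of the monomials of degree at most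
`m` are those of the Fubini–Study measure up to a factor, and whose Bergman space is spanned by
these monomials. -/
theorem isBergmanKernel_of_norm_monomials {n m : ℕ} {Ω : Set (Fin n → ℂ)} (hO : IsOpen Ω)
    (hΩ : IsReinhardt Ω) {C : ℝ} (hC : 0 < C)
    (hA : bergmanSpace Ω =
      Submodule.span ℂ {f : Ω → ℂ | ∃ α : Fin n → ℕ, ∑ j, α j ≤ m ∧ f = monomialOn Ω α})
    (hnorm : ∀ b : Finset.piAntidiag (Finset.univ : Finset (Fin (n + 1))) m,
      bergmanInner Ω (monomialOn Ω fun j => b.1 (Fin.succ j))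
        (monomialOn Ω fun j => b.1 (Fin.succ j)) =
        (((∏ i, ((b.1 i).factorial : ℝ)) / (m.factorial * C) : ℝ) : ℂ)) :
    IsBergmanKernel Ω fun z w => C * (1 + ∑ j, z j * conj (w j)) ^ m := by
  classical
  -- The normalizing factors: `N b ^ 2`, the inverse of the squared norm of the monomial, is `C`
  -- times a multinomial coefficient. Hence the kernel is `C` times the multinomial expansion.
  let N : Finset.piAntidiag (Finset.univ : Finset (Fin (n + 1))) m → ℝ := fun b =>
    √(m.factorial * C / ∏ i, ((b.1 i).factorial : ℝ))
  have hf : ∀ b : Finset.piAntidiag (Finset.univ : Finset (Fin (n + 1))) m,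
      0 < ∏ i, ((b.1 i).factorial : ℝ) := fun b =>
    Finset.prod_pos fun i _ => by exact_mod_cast Nat.factorial_pos _
  have hm : (0 : ℝ) < m.factorial := by exact_mod_cast Nat.factorial_pos _
  have hN0 : ∀ b : Finset.piAntidiag (Finset.univ : Finset (Fin (n + 1))) m,
      0 < m.factorial * C / ∏ i, ((b.1 i).factorial : ℝ) := fun b => by
    have := hf b
    positivity
  have hN : ∀ b : Finset.piAntidiag (Finset.univ : Finset (Fin (n + 1))) m,
      N b * N b = m.factorial * C / ∏ i, ((b.1 i).factorial : ℝ) := fun b =>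
    Real.mul_self_sqrt (hN0 b).le
  let φ : Finset.piAntidiag (Finset.univ : Finset (Fin (n + 1))) m → Ω → ℂ := fun b =>
    (N b : ℂ) • monomialOn Ω fun j => b.1 (Fin.succ j)
  have hφspan : bergmanSpace Ω = Submodule.span ℂ (Set.range φ) := by
    rw [hA, setOf_monomialOn_eq_range]
    refine le_antisymm (Submodule.span_le.2 ?_) (Submodule.span_le.2 ?_)
    · rintro _ ⟨b, rfl⟩
      have hne : (N b : ℂ) ≠ 0 :=
        Complex.ofReal_ne_zero.2 (Real.sqrt_pos.2 (hN0 b)).ne'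
      have : (monomialOn Ω fun j => b.1 (Fin.succ j)) = (N b : ℂ)⁻¹ • φ b := by
        simp only [φ, smul_smul, inv_mul_cancel₀ hne, one_smul]
      simp only
      rw [this]
      exact Submodule.smul_mem _ _ (Submodule.subset_span ⟨b, rfl⟩)
    · rintro _ ⟨b, rfl⟩
      exact Submodule.smul_mem _ _ (Submodule.subset_span ⟨b, rfl⟩)
  refine ⟨_, φ, IsBergmanBasis.of_span_eq hφspan fun b c => ?_, fun z w => ?_⟩
  · simp only [φ]
    rw [bergmanInner_smul_smul]
    split_ifs with h
    · subst h
      rw [hnorm, Complex.conj_ofReal, ← Complex.ofReal_mul, hN, ← Complex.ofReal_mul,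
        ← Complex.ofReal_one]
      have := (hf b).ne'
      congr 1
      field_simp
    · rw [bergmanInner_monomialOn_of_ne hO hΩ fun h' => h (piAntidiag_ext_succ h'), mul_zero]
  · convert hasSum_fintype _ using 1
    simp only
    rw [one_add_sum_pow_eq, Finset.mul_sum]
    refine Finset.sum_congr rfl fun b _ => ?_
    have hN' : (N b : ℂ) * N b = m.factorial * C / ∏ i, ((b.1 i).factorial : ℂ) := by
      exact_mod_cast congrArg (fun x : ℝ => (x : ℂ)) (hN b)
    simp only [φ, Pi.smul_apply, smul_eq_mul, map_mul, Complex.conj_ofReal, monomialOn, map_prod,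
      map_pow, mul_pow, Finset.prod_mul_distrib]
    linear_combination (-(∏ j, z.1 j ^ b.1 (Fin.succ j)) *
      ∏ j, conj (w.1 j) ^ b.1 (Fin.succ j)) * hN'

theorem theorem1 (m n : ℕ) (hm : 1 ≤ m) (hn : 2 ≤ n) :
    ∃ C₀ : ℝ, 0 < C₀ ∧ ∀ C : ℝ, C₀ < C →
      ∃ Ω : Set (Fin n → ℂ),
        IsDomainIn Ω ∧ IsReinhardt Ω ∧ ¬ Bornology.IsBounded Ω ∧
        -- the Bergman space
        bergmanSpace Ω =
          Submodule.span ℂ {f : Ω → ℂ | ∃ α : Fin n → ℕ, ∑ j, α j ≤ m ∧ f = monomialOn Ω α} ∧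
        BergmanSeparatesPoints Ω ∧
        -- the conditions under which the Bergman metric is defined
        BergmanBasePointFree Ω ∧ BergmanSeparatesDirections Ω ∧
        -- the Bergman kernel and the Bergman metric
        ∃ K : (Fin n → ℂ) → (Fin n → ℂ) → ℂ,
          IsBergmanKernel Ω K ∧
          (∀ z ∈ Ω, K z z = ((C * (1 + ∑ j, ‖z j‖ ^ 2) ^ m : ℝ) : ℂ)) ∧
          ∀ z ∈ Ω, ∀ v w : Fin n → ℂ,
            bergmanMetric K z v w = (m : ℂ) * fubiniStudyAffine z v w := by
  let i : Fin n := ⟨0, by omega⟩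
  let j : Fin n := ⟨1, by omega⟩
  have hij : i ≠ j := fun h => by simp [i, j] at h
  obtain ⟨ε₀, hε₀, H⟩ := exists_isUnionOfBallsAt_setIntegral_eq m (i := i) (j := j)
  -- The squared norms must be `∏ bᵢ! / (m! C)`, so `ε = 1 / (m! C)`; this is less than `ε₀` exactly
  -- when `C` exceeds the constant given here.
  refine ⟨1 / (m.factorial * ε₀), by positivity, fun C hC₀ => ?_⟩
  have hC : 0 < C := lt_trans (by positivity) hC₀
  obtain ⟨Λ, D, hΛ, hD, hDint, hDeq, hDinf⟩ := H (1 / (m.factorial * C)) (by positivity) (by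
    rw [div_lt_iff₀ (by positivity)] at hC₀ ⊢
    linarith)
  have hDm := hD.isOpen.measurableSet
  have hO : IsOpen (radialMap n ⁻¹' D) := hD.isOpen.preimage (continuous_radialMap n)
  have hR := isReinhardt_preimage_radialMap D
  have hpre : IsPreconnected (radialMap n ⁻¹' D) := by
    refine isPreconnected_preimage_radialMap (hD.isPreconnected_inter ?_ (fun t ht => ht.1)
      (isPreconnected_comb hij))
    intro t ht u hu a b ha hb _ k
    exact add_nonneg (mul_nonneg ha (ht k)) (mul_nonneg hb (hu k))
  have h0 : (0 : Fin n → ℂ) ∈ radialMap n ⁻¹' D :=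
    hD.1 ⟨fun k => sq_nonneg _, Or.inl (by simp [radialMap])⟩
  have hcoord : ∀ b : Finset.piAntidiag (Finset.univ : Finset (Fin (n + 1))) m,
      IntegrableOn (fun t => momentVector m t b) D (radialMeasure n) ∧
      ∫ t in D, momentVector m t b ∂radialMeasure n =
        (∏ k, ((b.1 k).factorial : ℝ)) / (m.factorial * C) := by
    intro b
    let p := ContinuousLinearMap.proj (R := ℝ)
      (φ := fun _ : Finset.piAntidiag (Finset.univ : Finset (Fin (n + 1))) m => ℝ) b
    refine ⟨p.integrable_comp hDint, ?_⟩
    have := p.integral_comp_comm hDint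
    rw [hDeq] at this
    refine this.trans ?_
    simp only [p, ContinuousLinearMap.proj_apply, Pi.smul_apply, smul_eq_mul]
    ring
  have hA : bergmanSpace (radialMap n ⁻¹' D) = Submodule.span ℂ
      {f : radialMap n ⁻¹' D → ℂ | ∃ α : Fin n → ℕ, ∑ j, α j ≤ m ∧
        f = monomialOn (radialMap n ⁻¹' D) α} := by
    refine bergmanSpace_eq_span_monomials hO hpre hR h0 (fun α hα => ?_) fun α hα => by
      rw [lintegral_monomial_preimage_radialMap hDm, hDinf α hα]
    rw [lintegral_monomial_preimage_radialMap hDm]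
    let b : Finset.piAntidiag (Finset.univ : Finset (Fin (n + 1))) m :=
      ⟨Fin.cons (m - ∑ j, α j) α, by
        rw [Finset.mem_piAntidiag, Fin.sum_univ_succ]
        simp [Nat.sub_add_cancel hα]⟩
    have hb := (hcoord b).1.2
    rw [HasFiniteIntegral] at hb
    convert hb using 2 with t
    ext t
    rw [momentVector, ← Real.enorm_abs, Finset.abs_prod]
    simp only [b, Fin.cons_succ, abs_pow]
    rw [← ofReal_norm, Real.norm_of_nonneg (by positivity),
      ENNReal.ofReal_prod_of_nonneg fun _ _ => by positivity]
    refine Finset.prod_congr rfl fun k _ => ?_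
    rw [ENNReal.ofReal_pow (abs_nonneg _), ← Real.norm_eq_abs, ofReal_norm]
  have hK : ∀ z : Fin n → ℂ, (C : ℂ) * (1 + ∑ j, z j * conj (z j)) ^ m =
      ((C * (1 + ∑ j, ‖z j‖ ^ 2) ^ m : ℝ) : ℂ) := fun z => by
    simp only [Complex.mul_conj']
    push_cast
    rfl
  refine ⟨radialMap n ⁻¹' D, ⟨hO, ⟨0, h0⟩, hpre⟩, hR, fun hbdd => ?_, hA,
    bergmanSeparatesPoints_of_eq_span hm hA, bergmanBasePointFree_of_eq_span hA,
    bergmanSeparatesDirections_of_eq_span hm hA,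
    fun z w => C * (1 + ∑ j, z j * conj (w j)) ^ m,
    isBergmanKernel_of_norm_monomials hO hR hC hA fun b => ?_, fun z _ => hK z,
    fun z _ v w => bergmanMetric_eq_fubiniStudyAffine hC m hK z v w⟩
  · obtain ⟨M, hM⟩ := hbdd.exists_norm_le
    obtain ⟨k, hk⟩ := exists_nat_gt (M ^ 2)
    have hk1 : (0 : ℝ) ≤ (k : ℝ) + 1 := by positivity
    -- The comb contains the diagonal points `(k+1, …, k+1)`, so `Ω` contains points with all moduli
    -- equal to `√(k+1)`.
    have hmem : (fun _ => (√((k : ℝ) + 1) : ℂ) : Fin n → ℂ) ∈ radialMap n ⁻¹' D := by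
      have hr : radialMap n (fun _ => (√((k : ℝ) + 1) : ℂ)) = fun _ => (k : ℝ) + 1 := by
        ext l
        rw [radialMap, Complex.norm_real, Real.norm_of_nonneg (Real.sqrt_nonneg _),
          Real.sq_sqrt hk1]
      rw [Set.mem_preimage, hr]
      exact hD.1 ⟨fun _ => hk1, Or.inr (hΛ k)⟩
    have h1 := (norm_le_pi_norm _ i).trans (hM _ hmem)
    rw [Complex.norm_real, Real.norm_of_nonneg (Real.sqrt_nonneg _)] at h1
    have h2 := pow_le_pow_left₀ (Real.sqrt_nonneg _) h1 2
    rw [Real.sq_sqrt hk1] at h2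
    linarith
  · rw [← (hcoord b).2, ← integral_monomial_mul_conj_preimage_radialMap hDm]
    exact integral_lebesgueOn hO fun z : Fin n → ℂ =>
      (∏ j, z j ^ b.1 (Fin.succ j)) * conj (∏ j, z j ^ b.1 (Fin.succ j))
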